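/- Let $(\xi(k))_{k\in\mathbb Z}$ be i.i.d. with $P(\xi(k)=0)=P(\xi(k)=1)=\tfrac12$, and let $(S(k))_{k\ge 0}$ be a simple symmetric random walk on $\mathbb Z$ with $S(0)=0$, independent of $\xi$. Let $\varphi:\mathbb Z\to\{0,1\}$ be the $4$-periodic function with $\varphi(0)=\varphi(1)=\xi(0)$ and $\varphi(2)=\varphi(3)=1-\xi(0)$, and let $R:\mathbb Z\to\mathbb Z$ be the unique function with $R(0)=0$, $|R(k+1)-R(k)|=1$ and $\varphi(R(k))=\xi(k)$ for all $k\in\mathbb Z$. For a path $T$ indexed by $\mathbb N=\{0,1,2,\dots\}$ or by $\mathbb Z$ and integers $x_1\ne x_2$, a pair of times $(t_1,t_2)$ is a *crossing by $T$ of $(x_1,x_2)$* if $T(t_1)=x_1$, $T(t_2)=x_2$ and $T(t)$ lies strictly between $x_1$ and $x_2$ for every integer $t$ strictly between $t_1$ and $t_2$ (both $t_1<t_2$ and $t_2<t_1$ are allowed); it is *straight* if $|t_1-t_2|=|x_1-x_2|$. The *first crossing by $T$ of $(x_3,x_4)$ during $(t_1,t_2)$* is the crossing by $T$ of $(x_3,x_4)$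 with both times in $[\min\{t_1,t_2\},\max\{t_1,t_2\}]$ which is closest to $t_1$. Distinct crossings of the same $(x_1,x_2)$ occupy time intervals with disjoint interiors, and crossings by a path indexed by $\mathbb N$ are numbered $1,2,\dots$ in order of appearance. For $z\in\mathbb Z\setminus\{0\}$, the *$z$-th crossing by $R$* of an interval is the $z$-th crossing by $(R(k))_{k\ge0}$ if $z>0$, and the $|z|$-th crossing by $(R(k))_{k\le0}$, counted in reverse order starting at $0$, if $z<0$. Let $n\ge1$, and let $z_a,z_b\in\mathbb Z\setminus\{0\}$ and $i_a,i_b\in\{1,2,\dots\}$ be nonrandom with $(i_a,z_a)\neq(i_b,z_b)$. Let $(t_{1a},t_{2a})$ be the $i_a$-th crossing by $S$ of the $z_a$-th crossing by $R$ of $(0,3n)$, and let $(t_{1b},t_{2b})$ be the $i_b$-th crossing by $S$ of the $z_b$-th crossing by $R$ of $(0,3n)$. Almost surely these exist and are crossings by $R\circ S$ of $(0,3n)$. For $0\le m<n$ let $w_a(m)=1$ if the first crossing by $R\circ S$ of $(3m,3m+3)$ during $(t_{1a},t_{2a})$ is straight, and $w_a(m)=0$ otherwise; define $w_b(m)$ likewise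 from $(t_{1b},t_{2b})$, and let $w_a\times w_b:=\sum_{m=0}^{n-1}w_a(m)\,w_b(m)$. Then: - ($H_0$) if $z_a=z_b$, then almost surely $(S(t_{1a}),S(t_{2a}))=(S(t_{1b}),S(t_{2b}))$, and $w_a\times w_b$ has the binomial distribution with parameters $n$ and $(3/4)^3$; - ($H_1$) if $z_a\ne z_b$, then almost surely $(S(t_{1a}),S(t_{2a}))\ne(S(t_{1b}),S(t_{2b}))$, and $w_a\times w_b$ has the binomial distribution with parameters $n$ and $(3/4)^4$. -/

import Mathlib

open MeasureTheory ProbabilityTheory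

noncomputable section

/-! ### Random sceneries and simple random walks -/

/-- The colours `ξ k`, `k ∈ ℤ`, are i.i.d. and each of them is `0` or `1` with probability `1/2`. -/
structure IsFairScenery {Ω : Type*} [MeasurableSpace Ω] (P : Measure Ω) (ξ : ℤ → Ω → Fin 2) :
    Prop where
  measurable : ∀ k, Measurable (ξ k)
  indep : iIndepFun ξ P
  fair : ∀ k c, P {ω | ξ k ω = c} = 1 / 2

/-- `S` is a simple symmetric random walk on `ℤ` starting at the origin. -/
structure IsSimpleRandomWalk {Ω : Type*} [MeasurableSpace Ω] (P : Measure Ω) (S : ℕ → Ω → ℤ) :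
    Prop where
  measurable : ∀ k, Measurable (S k)
  start : ∀ᵐ ω ∂P, S 0 ω = 0
  indep : iIndepFun (fun k ω => S (k + 1) ω - S k ω) P
  step_right : ∀ k, P {ω | S (k + 1) ω - S k ω = 1} = 1 / 2
  step_left : ∀ k, P {ω | S (k + 1) ω - S k ω = -1} = 1 / 2

/-! ### The representation of a scenery as a nearest-neighbor walk -/

/-- The 4-periodic scenery with values `c, c, 1 - c, 1 - c` at `0, 1, 2, 3`. -/
def periodicScenery (c : Fin 2) (x : ℤ) : Fin 2 :=
  if x % 4 = 0 ∨ x % 4 = 1 then c else 1 - c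

/-- The walk on `ℕ` that starts at `0` and reads the colours `ξ 0, ξ 1, ξ 2, …` on the 4-periodic
scenery with `φ 0 = φ 1 = ξ 0`: in each step it moves to the neighbor which has the right colour. -/
def halfSceneryWalk (ξ : ℤ → Fin 2) : ℕ → ℤ
  | 0 => 0
  | k + 1 =>
    if periodicScenery (ξ 0) (halfSceneryWalk ξ k + 1) = ξ (k + 1) then halfSceneryWalk ξ k + 1
    else halfSceneryWalk ξ k - 1

/-- The nearest-neighbor walk `R : ℤ → ℤ` representing the scenery `ξ`; its characterization is
`eq_sceneryWalk_iff` below. -/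
def sceneryWalk (ξ : ℤ → Fin 2) (k : ℤ) : ℤ :=
  if 0 ≤ k then halfSceneryWalk ξ k.natAbs else halfSceneryWalk (fun j => ξ (-j)) k.natAbs

theorem periodicScenery_step (c d : Fin 2) (x : ℤ) :
    (periodicScenery c (x + 1) = d ∧ periodicScenery c (x - 1) ≠ d) ∨
      (periodicScenery c (x + 1) ≠ d ∧ periodicScenery c (x - 1) = d) := by
  have h : ∀ c d : Fin 2, (c = d ∧ 1 - c ≠ d) ∨ (c ≠ d ∧ 1 - c = d) := by decide
  have h' := h c d
  unfold periodicScenery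
  have h4 : x % 4 = 0 ∨ x % 4 = 1 ∨ x % 4 = 2 ∨ x % 4 = 3 := by omega
  rcases h4 with h0 | h0 | h0 | h0
  · rw [if_pos (by omega), if_neg (by omega)]; exact h'
  · rw [if_neg (by omega), if_pos (by omega)]; tauto
  · rw [if_neg (by omega), if_pos (by omega)]; tauto
  · rw [if_pos (by omega), if_neg (by omega)]; exact h'

theorem eq_halfSceneryWalk_iff (ξ : ℤ → Fin 2) (R : ℕ → ℤ) :
    ((∀ k, |R (k + 1) - R k| = 1) ∧ R 0 = 0 ∧ ∀ k : ℕ, periodicScenery (ξ 0) (R k) = ξ k) ↔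
      R = halfSceneryWalk ξ := by
  constructor
  · rintro ⟨h1, h2, h3⟩
    funext k
    induction k with
    | zero => exact h2
    | succ k ih =>
      have hs := periodicScenery_step (ξ 0) (ξ (k + 1)) (R k)
      have h := h3 (k + 1)
      push_cast at h
      rw [halfSceneryWalk, ← ih]
      rcases (abs_eq one_pos.le).1 (h1 k) with e | e
      · have e' : R (k + 1) = R k + 1 := by omega
        rw [e'] at h ⊢
        rw [if_pos h]
      · have e' : R (k + 1) = R k - 1 := by omega
        rw [e'] at h ⊢
        rw [if_neg (by tauto)]
  · rintro rfl
    refine ⟨fun k => ?_, rfl, fun k => ?_⟩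
    · rw [halfSceneryWalk]
      split_ifs <;> simp
    · cases k with
      | zero => simp [halfSceneryWalk, periodicScenery]
      | succ k =>
        have hs := periodicScenery_step (ξ 0) (ξ (k + 1)) (halfSceneryWalk ξ k)
        rw [halfSceneryWalk]
        push_cast
        split_ifs with h
        · exact h
        · tauto

/-- `sceneryWalk ξ` is the only nearest-neighbor walk `R : ℤ → ℤ` with `R 0 = 0` and `φ ∘ R = ξ`,
where `φ` is the 4-periodic scenery determined by `ξ 0`. -/
theorem eq_sceneryWalk_iff (ξ : ℤ → Fin 2) (R : ℤ → ℤ) :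
    ((∀ k, |R (k + 1) - R k| = 1) ∧ R 0 = 0 ∧ ∀ k, periodicScenery (ξ 0) (R k) = ξ k) ↔
      R = sceneryWalk ξ := by
  have hp : ∀ k : ℕ, sceneryWalk ξ k = halfSceneryWalk ξ k := fun k => by simp [sceneryWalk]
  have hm : ∀ k : ℕ, sceneryWalk ξ (-k) = halfSceneryWalk (fun j => ξ (-j)) k := fun k => by
    rcases Nat.eq_zero_or_pos k with rfl | hk
    · simp [sceneryWalk, halfSceneryWalk]
    · rw [sceneryWalk, if_neg (by omega), Int.natAbs_neg, Int.natAbs_natCast]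
  have key : R = sceneryWalk ξ ↔ ((fun k : ℕ => R k) = halfSceneryWalk ξ ∧
      (fun k : ℕ => R (-k)) = halfSceneryWalk (fun j => ξ (-j))) := by
    constructor
    · rintro rfl
      exact ⟨funext hp, funext hm⟩
    · rintro ⟨h1, h2⟩
      funext k
      obtain ⟨k, rfl | rfl⟩ := k.eq_nat_or_neg
      · rw [hp, ← h1]
      · rw [hm, ← h2]
  rw [key, ← eq_halfSceneryWalk_iff, ← eq_halfSceneryWalk_iff]
  constructor
  · rintro ⟨h1, h2, h3⟩
    refine ⟨⟨fun k => ?_, h2, fun k => h3 k⟩, ⟨fun k => ?_, by simpa using h2, fun k => ?_⟩⟩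
    · simpa using h1 k
    · have := h1 (-(k + 1))
      rw [abs_sub_comm]
      simpa using this
    · simpa using h3 (-k)
  · rintro ⟨⟨a1, a2, a3⟩, ⟨b1, -, b3⟩⟩
    refine ⟨fun k => ?_, a2, fun k => ?_⟩
    · rcases le_or_gt 0 k with hk | hk
      · obtain ⟨j, rfl⟩ := Int.eq_ofNat_of_zero_le hk
        simpa using a1 j
      · obtain ⟨j, hj⟩ := Int.eq_ofNat_of_zero_le (show 0 ≤ -(k + 1) by omega)
        have := b1 j
        rw [abs_sub_comm] at this
        have e1 : -((j : ℤ)) = k + 1 := by omega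
        have e2 : -(((j + 1 : ℕ) : ℤ)) = k := by push_cast; omega
        simpa only [e1, e2] using this
    · obtain ⟨k, rfl | rfl⟩ := k.eq_nat_or_neg
      · exact a3 k
      · simpa using b3 k

/-! ### Crossings

The index set `ι` of the path `T` is `ℕ` or `ℤ`. A crossing `(t₁, t₂)` may be positive (`t₁ < t₂`)
or negative (`t₂ < t₁`). -/

/-- `t = (t₁, t₂)` is a crossing by `T` of `(x₁, x₂)`. -/
def IsCrossing {ι : Type*} [LinearOrder ι] (T : ι → ℤ) (x₁ x₂ : ℤ) (t : ι × ι) : Prop :=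
  x₁ ≠ x₂ ∧ T t.1 = x₁ ∧ T t.2 = x₂ ∧
    ∀ s, min t.1 t.2 < s → s < max t.1 t.2 → min x₁ x₂ < T s ∧ T s < max x₁ x₂

/-- `t` is the `i`-th crossing by `T : ℕ → ℤ` of `(x₁, x₂)` in order of appearance, `i = 1, 2, …`
(positive and negative crossings are counted together). -/
def IsNthCrossing (T : ℕ → ℤ) (x₁ x₂ : ℤ) (i : ℕ) (t : ℕ × ℕ) : Prop :=
  IsCrossing T x₁ x₂ t ∧
    {s : ℕ × ℕ | IsCrossing T x₁ x₂ s ∧ max s.1 s.2 ≤ min t.1 t.2}.encard + 1 = i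

/-- `k` is the `z`-th crossing by `R : ℤ → ℤ` of `(x₁, x₂)`, `z ∈ ℤ`, `z ≠ 0`. For `z > 0` it is the
`z`-th crossing by the path `R` restricted to `[0, ∞)`; for `z < 0` it is the `|z|`-th crossing by the
path `R` restricted to `(-∞, 0]`, counted in reverse order starting at zero. -/
def IsSignedCrossing (R : ℤ → ℤ) (x₁ x₂ z : ℤ) (k : ℤ × ℤ) : Prop :=
  IsCrossing R x₁ x₂ k ∧
    ((0 < z ∧ 0 ≤ k.1 ∧ 0 ≤ k.2 ∧
        {s : ℤ × ℤ | IsCrossing R x₁ x₂ s ∧ 0 ≤ min s.1 s.2 ∧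
          max s.1 s.2 ≤ min k.1 k.2}.encard + 1 = z.natAbs) ∨
      (z < 0 ∧ k.1 ≤ 0 ∧ k.2 ≤ 0 ∧
        {s : ℤ × ℤ | IsCrossing R x₁ x₂ s ∧ max s.1 s.2 ≤ 0 ∧
          max k.1 k.2 ≤ min s.1 s.2}.encard + 1 = z.natAbs))

/-- `t` is the `i`-th crossing by `S` of the `z`-th crossing by `R` of `(0, 3n)`. -/
def IsIndexedCrossing (R : ℤ → ℤ) (S : ℕ → ℤ) (n i : ℕ) (z : ℤ) (t : ℕ × ℕ) : Prop :=
  ∃ k : ℤ × ℤ, IsSignedCrossing R 0 (3 * n) z k ∧ IsNthCrossing S k.1 k.2 i t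

/-- The `i`-th crossing by `S` of the `z`-th crossing by `R` of `(0, 3n)` (an arbitrary pair if there
is no such crossing). -/
def indexedCrossing (R : ℤ → ℤ) (S : ℕ → ℤ) (n i : ℕ) (z : ℤ) : ℕ × ℕ :=
  Classical.epsilon (IsIndexedCrossing R S n i z)

/-! ### The test statistic -/

/-- `s` is the first crossing by `T` of `(x₁, x₂)` during `t = (t₁, t₂)`: both times of `s` lie in
`[min t₁ t₂, max t₁ t₂]`, and among all such crossings `s` is the closest one to `t₁`. -/
def IsFirstCrossingDuring (T : ℕ → ℤ) (x₁ x₂ : ℤ) (t s : ℕ × ℕ) : Prop :=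
  IsCrossing T x₁ x₂ s ∧ s.1 ∈ Set.uIcc t.1 t.2 ∧ s.2 ∈ Set.uIcc t.1 t.2 ∧
    ∀ r : ℕ × ℕ, IsCrossing T x₁ x₂ r → r.1 ∈ Set.uIcc t.1 t.2 → r.2 ∈ Set.uIcc t.1 t.2 →
      |(s.1 : ℤ) - t.1| ≤ |(r.1 : ℤ) - t.1| ∧ |(s.2 : ℤ) - t.1| ≤ |(r.2 : ℤ) - t.1|

open Classical in
/-- The bit `w(m)` of the binary word of the crossing `t` by `T`: it is `1` if the first crossing by
`T` of `(3m, 3m + 3)` during `t` is straight, and `0` otherwise. -/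
def straightBit (T : ℕ → ℤ) (t : ℕ × ℕ) (m : ℕ) : ℕ :=
  if ∃ s, IsFirstCrossingDuring T (3 * m) (3 * m + 3) t s ∧
      |(s.1 : ℤ) - s.2| = |(3 * m : ℤ) - (3 * m + 3)| then 1 else 0

/-- The scalar product `w_a × w_b` of the binary words of length `n` of the crossings `a` and `b`
by `T`. -/
def commonStraight (T : ℕ → ℤ) (n : ℕ) (a b : ℕ × ℕ) : ℕ :=
  ∑ m ∈ Finset.range n, straightBit T a m * straightBit T b m

/-- The number `3/4` as an element of the unit interval. -/
def threeQuarters : unitInterval := ⟨3 / 4, by norm_num, by norm_num⟩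

end

/-!
Inserting a two-step backtrack after a fixed step of a path multiplies its probability by `1/4`.
A crossing of an interval of length `3` which is not straight begins with a step and a backtrack,
and deleting this backtrack yields an arbitrary crossing. Hence the first crossing of such an
interval during a prescribed crossing of a longer one is straight with probability `3/4`, and
independently so for crossings that differ in the interval or in the index of the longer crossing,
as a deletion for one of them does not affect the others.

The two halves of the scenery walk `R` are independent simple random walks, so this applies to `R`
as well as to `S`. The first crossing by `R ∘ S` of `(3m, 3m + 3)` is straight if and only if both
the underlying crossing by `R` and the crossing of its image by `S` are. Conditionally on `R`, each
factor `w_a(m) w_b(m)` thus requires two straight crossings by `S`, and one or two by `R` according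
to whether `z_a = z_b`.
-/

/-! ### Crossings by nearest-neighbor paths -/

/-- `T` is a nearest-neighbor path on `ℤ`: successive values differ by one. -/
def IsNearestNeighbor (T : ℕ → ℤ) : Prop := ∀ k, T (k + 1) = T k + 1 ∨ T (k + 1) = T k - 1

namespace IsNearestNeighbor

variable {T : ℕ → ℤ} {x₁ x₂ : ℤ}

theorem exists_eq_of_le (hT : IsNearestNeighbor T) {a b : ℕ} (hab : a ≤ b) {v : ℤ}
    (hv : v ∈ Set.uIcc (T a) (T b)) : ∃ c ∈ Set.Icc a b, T c = v := by
  induction b, hab using Nat.le_induction with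
  | base => exact ⟨a, Set.left_mem_Icc.2 le_rfl, by rw [Set.uIcc_self] at hv; exact hv.symm⟩
  | succ b hb ih =>
    by_cases h : v ∈ Set.uIcc (T a) (T b)
    · obtain ⟨c, hc, hcv⟩ := ih h
      exact ⟨c, Set.Icc_subset_Icc_right (Nat.le_succ b) hc, hcv⟩
    · refine ⟨b + 1, Set.right_mem_Icc.2 (by omega), ?_⟩
      rw [Set.mem_uIcc] at h hv
      have := hT b
      omega

theorem exists_eq (hT : IsNearestNeighbor T) {a b : ℕ} {v : ℤ}
    (hv : v ∈ Set.uIcc (T a) (T b)) : ∃ c ∈ Set.uIcc a b, T c = v := by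
  rcases le_total a b with h | h
  · simpa only [Set.uIcc_of_le h] using hT.exists_eq_of_le h hv
  · rw [Set.uIcc_comm] at hv
    simpa only [Set.uIcc_of_ge h] using hT.exists_eq_of_le h hv

theorem abs_sub_le (hT : IsNearestNeighbor T) (a b : ℕ) : |T a - T b| ≤ |(a : ℤ) - b| := by
  wlog h : a ≤ b generalizing a b
  · rw [abs_sub_comm, abs_sub_comm (a : ℤ)]
    exact this b a (by omega)
  induction b, h using Nat.le_induction with
  | base => simp
  | succ b hb ih =>
    have := hT b
    push_cast
    rw [abs_le] at ih ⊢
    rw [abs_of_nonpos (by omega)] at ih ⊢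
    omega

end IsNearestNeighbor

namespace IsCrossing

variable {ι : Type*} [LinearOrder ι] {T : ι → ℤ} {x₁ x₂ : ℤ} {s t : ι × ι}

theorem apply_min (h : IsCrossing T x₁ x₂ t) :
    T (min t.1 t.2) = x₁ ∨ T (min t.1 t.2) = x₂ := by
  rcases min_choice t.1 t.2 with e | e <;> rw [e]
  exacts [Or.inl h.2.1, Or.inr h.2.2.1]

theorem apply_max (h : IsCrossing T x₁ x₂ t) :
    T (max t.1 t.2) = x₁ ∨ T (max t.1 t.2) = x₂ := by
  rcases max_choice t.1 t.2 with e | e <;> rw [e]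
  exacts [Or.inl h.2.1, Or.inr h.2.2.1]

theorem fst_ne_snd (h : IsCrossing T x₁ x₂ t) : t.1 ≠ t.2 := fun e =>
  h.1 (by rw [← h.2.1, e, h.2.2.1])

theorem min_lt_max (h : IsCrossing T x₁ x₂ t) : min t.1 t.2 < max t.1 t.2 :=
  _root_.min_lt_max.2 h.fst_ne_snd

theorem apply_ne_of_mem_Ioo (h : IsCrossing T x₁ x₂ t) {u : ι}
    (hu : u ∈ Set.Ioo (min t.1 t.2) (max t.1 t.2)) : ¬(T u = x₁ ∨ T u = x₂) := by
  have := h.2.2.2 u hu.1 hu.2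
  omega

theorem eq_of_min_eq_of_max_eq (hs : IsCrossing T x₁ x₂ s) (ht : IsCrossing T x₁ x₂ t)
    (hmin : min s.1 s.2 = min t.1 t.2) (hmax : max s.1 s.2 = max t.1 t.2) : s = t := by
  obtain ⟨hne, hs₁, hs₂, -⟩ := hs
  obtain ⟨-, ht₁, ht₂, -⟩ := ht
  rcases le_total s.1 s.2 with hs | hs <;> rcases le_total t.1 t.2 with ht | ht <;>
    simp only [hs, ht, min_eq_left, min_eq_right, max_eq_left, max_eq_right] at hmin hmax
  · exact Prod.ext hmin hmax
  · exact absurd (by rw [← hs₁, hmin, ht₂]) hne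
  · exact absurd (by rw [← ht₁, ← hmin, hs₂]) hne
  · exact Prod.ext hmax hmin

theorem eq_of_overlap (hs : IsCrossing T x₁ x₂ s) (ht : IsCrossing T x₁ x₂ t)
    (hst : min s.1 s.2 < max t.1 t.2) (hts : min t.1 t.2 < max s.1 s.2) : s = t := by
  refine hs.eq_of_min_eq_of_max_eq ht ?_ ?_
  · rcases lt_trichotomy (min s.1 s.2) (min t.1 t.2) with h | h | h
    · exact absurd ht.apply_min (hs.apply_ne_of_mem_Ioo ⟨h, hts⟩)
    · exact h
    · exact absurd hs.apply_min (ht.apply_ne_of_mem_Ioo ⟨h, hst⟩)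
  · rcases lt_trichotomy (max s.1 s.2) (max t.1 t.2) with h | h | h
    · exact absurd hs.apply_max (ht.apply_ne_of_mem_Ioo ⟨hts, h⟩)
    · exact h
    · exact absurd ht.apply_max (hs.apply_ne_of_mem_Ioo ⟨hst, h⟩)

theorem eq_or_le_or_le (hs : IsCrossing T x₁ x₂ s) (ht : IsCrossing T x₁ x₂ t) :
    s = t ∨ max s.1 s.2 ≤ min t.1 t.2 ∨ max t.1 t.2 ≤ min s.1 s.2 := by
  by_contra! h
  exact h.1 (hs.eq_of_overlap ht h.2.2 h.2.1)

end IsCrossing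

theorem IsNearestNeighbor.exists_isCrossing {T : ℕ → ℤ} (hT : IsNearestNeighbor T) {x₁ x₂ : ℤ}
    (hx : x₁ ≠ x₂) {a b : ℕ} (ha : T a = x₁) (hb : T b = x₂) :
    ∃ s, IsCrossing T x₁ x₂ s ∧ s.1 ∈ Set.uIcc a b ∧ s.2 ∈ Set.uIcc a b := by
  induction hd : max a b - min a b using Nat.strong_induction_on generalizing a b with
  | _ d ih =>
    by_cases hin : ∀ s, min a b < s → s < max a b → min x₁ x₂ < T s ∧ T s < max x₁ x₂
    · exact ⟨(a, b), ⟨hx, ha, hb, hin⟩, Set.left_mem_uIcc, Set.right_mem_uIcc⟩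
    push Not at hin
    obtain ⟨c, hac, hcb, hc⟩ := hin
    obtain ⟨a', b', ha', hb', hsub, hlt⟩ : ∃ a' b', T a' = x₁ ∧ T b' = x₂ ∧
        Set.uIcc a' b' ⊆ Set.uIcc a b ∧ max a' b' - min a' b' < max a b - min a b := by
      have hbetween : x₁ ∈ Set.uIcc (T c) (T b) ∨ x₂ ∈ Set.uIcc (T a) (T c) := by
        simp only [Set.mem_uIcc]
        omega
      rcases hbetween with h | h <;> obtain ⟨u, hu, hux⟩ := hT.exists_eq h <;>
        rw [Set.mem_uIcc] at hu
      · exact ⟨u, b, hux, hb, Set.uIcc_subset_uIcc (Set.mem_uIcc.2 (by omega))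
          Set.right_mem_uIcc, by omega⟩
      · exact ⟨a, u, ha, hux, Set.uIcc_subset_uIcc Set.left_mem_uIcc
          (Set.mem_uIcc.2 (by omega)), by omega⟩
    obtain ⟨s, hs, hs₁, hs₂⟩ := ih _ (hd ▸ hlt) ha' hb' rfl
    exact ⟨s, hs, hsub hs₁, hsub hs₂⟩

/-! ### The crossing with a given number -/

/-- The crossings of `(x₁, x₂)` by `T` which are completed up to time `N`; `IsNthCrossing` counts
them. -/
def crossingsUpTo (T : ℕ → ℤ) (x₁ x₂ : ℤ) (N : ℕ) : Set (ℕ × ℕ) :=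
  {s | IsCrossing T x₁ x₂ s ∧ max s.1 s.2 ≤ N}

theorem IsCrossing.encard_insert_crossingsUpTo {T : ℕ → ℤ} {x₁ x₂ : ℤ} {s : ℕ × ℕ}
    (hs : IsCrossing T x₁ x₂ s) :
    (insert s (crossingsUpTo T x₁ x₂ (min s.1 s.2))).encard =
      (crossingsUpTo T x₁ x₂ (min s.1 s.2)).encard + 1 :=
  Set.encard_insert_of_notMem fun h => hs.min_lt_max.not_ge h.2

theorem IsNthCrossing.not_max_le_min {T : ℕ → ℤ} {x₁ x₂ : ℤ} {i : ℕ} {s t : ℕ × ℕ}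
    (hs : IsNthCrossing T x₁ x₂ i s) (ht : IsNthCrossing T x₁ x₂ i t) :
    ¬ max s.1 s.2 ≤ min t.1 t.2 := by
  intro hle
  have hsub : insert s (crossingsUpTo T x₁ x₂ (min s.1 s.2)) ⊆
      crossingsUpTo T x₁ x₂ (min t.1 t.2) :=
    Set.insert_subset ⟨hs.1, hle⟩ fun r hr =>
      ⟨hr.1, hr.2.trans (hs.1.min_lt_max.le.trans hle)⟩
  have hcount : (i : ℕ∞) + 1 ≤ i :=
    calc (i : ℕ∞) + 1 = (insert s (crossingsUpTo T x₁ x₂ (min s.1 s.2))).encard + 1 := by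
          rw [hs.1.encard_insert_crossingsUpTo, ← hs.2, crossingsUpTo]
      _ ≤ (crossingsUpTo T x₁ x₂ (min t.1 t.2)).encard + 1 := by gcongr
      _ = i := ht.2
  exact absurd (by exact_mod_cast hcount) (Nat.not_succ_le_self i)

theorem IsNthCrossing.unique {T : ℕ → ℤ} {x₁ x₂ : ℤ} {i : ℕ} {s t : ℕ × ℕ}
    (hs : IsNthCrossing T x₁ x₂ i s) (ht : IsNthCrossing T x₁ x₂ i t) : s = t := by
  rcases hs.1.eq_or_le_or_le ht.1 with h | h | h
  · exact h
  · exact absurd h (hs.not_max_le_min ht)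
  · exact absurd h (ht.not_max_le_min hs)

theorem IsNthCrossing.index_unique {T : ℕ → ℤ} {x₁ x₂ : ℤ} {i j : ℕ} {t : ℕ × ℕ}
    (hi : IsNthCrossing T x₁ x₂ i t) (hj : IsNthCrossing T x₁ x₂ j t) : i = j := by
  exact_mod_cast hi.2.symm.trans hj.2

/-- The path `T` visits every integer at arbitrarily late times. -/
def IsRecurrent (T : ℕ → ℤ) : Prop := ∀ (x : ℤ) (N : ℕ), ∃ k, N ≤ k ∧ T k = x

theorem IsNearestNeighbor.exists_isCrossing_after {T : ℕ → ℤ} (hT : IsNearestNeighbor T)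
    (hrec : IsRecurrent T) {x₁ x₂ : ℤ} (hx : x₁ ≠ x₂) (N : ℕ) :
    ∃ t, IsCrossing T x₁ x₂ t ∧ N ≤ min t.1 t.2 ∧
      ∀ r, IsCrossing T x₁ x₂ r → N ≤ min r.1 r.2 → max t.1 t.2 ≤ max r.1 r.2 := by
  obtain ⟨a, hNa, ha⟩ := hrec x₁ N
  obtain ⟨b, hNb, hb⟩ := hrec x₂ N
  obtain ⟨s, hs, hs₁, hs₂⟩ := hT.exists_isCrossing hx ha hb
  rw [Set.mem_uIcc] at hs₁ hs₂
  obtain ⟨t, ⟨ht, hNt⟩, hmin⟩ := (measure fun t : ℕ × ℕ => max t.1 t.2).wf.has_min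
    {t | IsCrossing T x₁ x₂ t ∧ N ≤ min t.1 t.2} ⟨s, hs, by omega⟩
  exact ⟨t, ht, hNt, fun r hr hNr => not_lt.1 (hmin r ⟨hr, hNr⟩)⟩

theorem IsNearestNeighbor.exists_isNthCrossing {T : ℕ → ℤ} (hT : IsNearestNeighbor T)
    (hrec : IsRecurrent T) {x₁ x₂ : ℤ} (hx : x₁ ≠ x₂) (i : ℕ) :
    ∃ t, IsNthCrossing T x₁ x₂ (i + 1) t := by
  induction i with
  | zero =>
    obtain ⟨t, ht, -, hfirst⟩ := hT.exists_isCrossing_after hrec hx 0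
    have hempty : crossingsUpTo T x₁ x₂ (min t.1 t.2) = ∅ :=
      Set.eq_empty_of_forall_notMem fun r hr =>
        ht.min_lt_max.not_ge ((hfirst r hr.1 (Nat.zero_le _)).trans hr.2)
    exact ⟨t, ht, by rw [← crossingsUpTo, hempty]; simp⟩
  | succ i ih =>
    obtain ⟨s, hs⟩ := ih
    obtain ⟨t, ht, hst, hnext⟩ := hT.exists_isCrossing_after hrec hx (max s.1 s.2)
    have hinsert : crossingsUpTo T x₁ x₂ (min t.1 t.2) =
        insert s (crossingsUpTo T x₁ x₂ (min s.1 s.2)) := by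
      refine subset_antisymm (fun r hr => ?_) (Set.insert_subset ⟨hs.1, hst⟩ fun r hr =>
        ⟨hr.1, hr.2.trans (hs.1.min_lt_max.le.trans hst)⟩)
      rcases hr.1.eq_or_le_or_le hs.1 with h | h | h
      · exact Or.inl h
      · exact Or.inr ⟨hr.1, h⟩
      · exact absurd ((hnext r hr.1 h).trans hr.2) ht.min_lt_max.not_ge
    refine ⟨t, ht, ?_⟩
    rw [← crossingsUpTo, hinsert, hs.1.encard_insert_crossingsUpTo, crossingsUpTo, hs.2]
    push_cast
    rfl

/-! ### The first crossing during a time interval -/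

theorem abs_sub_le_abs_sub_iff_mem_uIcc {a b r s : ℕ} (hs : s ∈ Set.uIcc a b)
    (hr : r ∈ Set.uIcc a b) : |(s : ℤ) - a| ≤ |(r : ℤ) - a| ↔ s ∈ Set.uIcc a r := by
  simp only [Set.mem_uIcc, abs_eq_max_neg] at *
  omega

theorem isFirstCrossingDuring_iff {T : ℕ → ℤ} {x₁ x₂ : ℤ} {t s : ℕ × ℕ} :
    IsFirstCrossingDuring T x₁ x₂ t s ↔
      IsCrossing T x₁ x₂ s ∧ s.1 ∈ Set.uIcc t.1 t.2 ∧ s.2 ∈ Set.uIcc t.1 t.2 ∧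
        ∀ r : ℕ × ℕ, IsCrossing T x₁ x₂ r → r.1 ∈ Set.uIcc t.1 t.2 → r.2 ∈ Set.uIcc t.1 t.2 →
          s.1 ∈ Set.uIcc t.1 r.1 ∧ s.2 ∈ Set.uIcc t.1 r.2 := by
  unfold IsFirstCrossingDuring
  refine and_congr_right fun _ => and_congr_right fun hs₁ => and_congr_right fun hs₂ => ?_
  refine forall_congr' fun r => imp_congr_right fun _ => imp_congr_right fun hr₁ =>
    imp_congr_right fun hr₂ => ?_
  rw [abs_sub_le_abs_sub_iff_mem_uIcc hs₁ hr₁, abs_sub_le_abs_sub_iff_mem_uIcc hs₂ hr₂]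

theorem IsFirstCrossingDuring.unique {T : ℕ → ℤ} {x₁ x₂ : ℤ} {t s r : ℕ × ℕ}
    (hs : IsFirstCrossingDuring T x₁ x₂ t s) (hr : IsFirstCrossingDuring T x₁ x₂ t r) :
    s = r := by
  rw [isFirstCrossingDuring_iff] at hs hr
  obtain ⟨hsc, hs₁, hs₂, hs⟩ := hs
  obtain ⟨hrc, hr₁, hr₂, hr⟩ := hr
  obtain ⟨hsr₁, hsr₂⟩ := hs r hrc hr₁ hr₂
  obtain ⟨hrs₁, hrs₂⟩ := hr s hsc hs₁ hs₂
  exact Prod.ext (Set.eq_of_mem_uIcc_of_mem_uIcc' hsr₁ hrs₁)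
    (Set.eq_of_mem_uIcc_of_mem_uIcc' hsr₂ hrs₂)

theorem IsCrossing.mem_uIcc_of_dist_add_dist_le {T : ℕ → ℤ} {x₁ x₂ : ℤ} {s r : ℕ × ℕ}
    (hs : IsCrossing T x₁ x₂ s) (hr : IsCrossing T x₁ x₂ r) {a b : ℕ}
    (hs₁ : s.1 ∈ Set.uIcc a b) (hs₂ : s.2 ∈ Set.uIcc a b)
    (hr₁ : r.1 ∈ Set.uIcc a b) (hr₂ : r.2 ∈ Set.uIcc a b)
    (hle : Nat.dist s.1 a + Nat.dist s.2 a ≤ Nat.dist r.1 a + Nat.dist r.2 a) :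
    s.1 ∈ Set.uIcc a r.1 ∧ s.2 ∈ Set.uIcc a r.2 := by
  have hlt := hs.min_lt_max
  have hlt' := hr.min_lt_max
  rcases hs.eq_or_le_or_le hr with rfl | h
  · exact ⟨Set.right_mem_uIcc, Set.right_mem_uIcc⟩
  · simp only [Set.mem_uIcc, Nat.dist] at *
    rcases le_total a b with hab | hab <;> rcases h with h | h <;> constructor <;> omega

theorem IsNearestNeighbor.exists_isFirstCrossingDuring {T : ℕ → ℤ} (hT : IsNearestNeighbor T)
    {x₁ x₂ : ℤ} (hx : x₁ ≠ x₂) {t : ℕ × ℕ} (hx₁ : x₁ ∈ Set.uIcc (T t.1) (T t.2))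
    (hx₂ : x₂ ∈ Set.uIcc (T t.1) (T t.2)) : ∃ s, IsFirstCrossingDuring T x₁ x₂ t s := by
  obtain ⟨a, ha, hax⟩ := hT.exists_eq hx₁
  obtain ⟨b, hb, hbx⟩ := hT.exists_eq hx₂
  obtain ⟨s₀, hs₀, hs₀₁, hs₀₂⟩ := hT.exists_isCrossing hx hax hbx
  have hsub : Set.uIcc a b ⊆ Set.uIcc t.1 t.2 := Set.uIcc_subset_uIcc ha hb
  obtain ⟨s, ⟨hs, hs₁, hs₂⟩, hmin⟩ :=
    (measure fun s : ℕ × ℕ => Nat.dist s.1 t.1 + Nat.dist s.2 t.1).wf.has_min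
      {s | IsCrossing T x₁ x₂ s ∧ s.1 ∈ Set.uIcc t.1 t.2 ∧ s.2 ∈ Set.uIcc t.1 t.2}
      ⟨s₀, hs₀, hsub hs₀₁, hsub hs₀₂⟩
  exact ⟨s, isFirstCrossingDuring_iff.2 ⟨hs, hs₁, hs₂, fun r hr hr₁ hr₂ =>
    hs.mem_uIcc_of_dist_add_dist_le hr hs₁ hs₂ hr₁ hr₂ (not_lt.1 (hmin r ⟨hr, hr₁, hr₂⟩))⟩⟩

section FirstHit

variable {T : ℕ → ℤ} {x₁ x₂ : ℤ} {t s : ℕ × ℕ}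

theorem IsFirstCrossingDuring.mem_uIcc_of_apply_eq (hT : IsNearestNeighbor T)
    (hs : IsFirstCrossingDuring T x₁ x₂ t s) (hx₁ : x₁ ∈ Set.uIcc (T t.1) x₂) {u : ℕ}
    (hu : u ∈ Set.uIcc t.1 t.2) (hux : T u = x₂) :
    s.1 ∈ Set.uIcc t.1 u ∧ s.2 ∈ Set.uIcc t.1 u := by
  rw [isFirstCrossingDuring_iff] at hs
  obtain ⟨hsc, -, -, hfirst⟩ := hs
  obtain ⟨a, ha, hax⟩ := hT.exists_eq (hux.symm ▸ hx₁ : x₁ ∈ Set.uIcc (T t.1) (T u))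
  obtain ⟨r, hr, hr₁, hr₂⟩ := hT.exists_isCrossing hsc.1 hax hux
  have hau : Set.uIcc a u ⊆ Set.uIcc t.1 u := Set.uIcc_subset_uIcc ha Set.right_mem_uIcc
  have hut : Set.uIcc t.1 u ⊆ Set.uIcc t.1 t.2 := Set.uIcc_subset_uIcc Set.left_mem_uIcc hu
  obtain ⟨h₁, h₂⟩ := hfirst r hr (hut (hau hr₁)) (hut (hau hr₂))
  exact ⟨Set.uIcc_subset_uIcc Set.left_mem_uIcc (hau hr₁) h₁,
    Set.uIcc_subset_uIcc Set.left_mem_uIcc (hau hr₂) h₂⟩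

theorem IsFirstCrossingDuring.fst_mem_uIcc (hT : IsNearestNeighbor T)
    (hs : IsFirstCrossingDuring T x₁ x₂ t s) (hx₁ : x₁ ∈ Set.uIcc (T t.1) x₂) :
    s.1 ∈ Set.uIcc t.1 s.2 :=
  (hs.mem_uIcc_of_apply_eq hT hx₁ hs.2.2.1 hs.1.2.2.1).1

theorem IsCrossing.isFirstCrossingDuring (hs : IsCrossing T x₁ x₂ s)
    (hs₁ : s.1 ∈ Set.uIcc t.1 s.2) (hs₂ : s.2 ∈ Set.uIcc t.1 t.2)
    (hhit : ∀ u ∈ Set.uIcc t.1 t.2, T u = x₂ → s.2 ∈ Set.uIcc t.1 u) :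
    IsFirstCrossingDuring T x₁ x₂ t s := by
  refine isFirstCrossingDuring_iff.2 ⟨hs, Set.uIcc_subset_uIcc Set.left_mem_uIcc hs₂ hs₁, hs₂,
    fun r hr hr₁ hr₂ => ?_⟩
  have hsr := hhit r.2 hr₂ hr.2.2.1
  refine ⟨by_contra fun hlate => ?_, hsr⟩
  refine hr.apply_ne_of_mem_Ioo (u := s.1) ?_ (Or.inl hs.2.1)
  have hne := hs.fst_ne_snd
  simp only [Set.mem_uIcc, Set.mem_Ioo] at *
  omega

end FirstHit

/-! ### Deleting a backtrack from a path -/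

/-- The increasing enumeration of all times except `b + 1` and `b + 2`; composing a path with it
deletes the two steps taken at the times `b` and `b + 1`. -/
def skipTwo (b t : ℕ) : ℕ := if t ≤ b then t else t + 2

theorem skipTwo_strictMono (b : ℕ) : StrictMono (skipTwo b) := fun s t h => by
  unfold skipTwo
  split_ifs <;> omega

theorem skipTwo_of_le {b t : ℕ} (h : t ≤ b) : skipTwo b t = t := if_pos h

theorem skipTwo_of_lt {b t : ℕ} (h : b < t) : skipTwo b t = t + 2 := if_neg (by omega)

theorem exists_skipTwo_eq {b u : ℕ} (h₁ : u ≠ b + 1) (h₂ : u ≠ b + 2) : ∃ v, skipTwo b v = u := by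
  rcases le_or_gt u b with h | h
  · exact ⟨u, skipTwo_of_le h⟩
  · exact ⟨u - 2, by rw [skipTwo_of_lt (by omega)]; omega⟩

theorem skipTwo_min (b s t : ℕ) : skipTwo b (min s t) = min (skipTwo b s) (skipTwo b t) :=
  (skipTwo_strictMono b).monotone.map_min

theorem skipTwo_max (b s t : ℕ) : skipTwo b (max s t) = max (skipTwo b s) (skipTwo b t) :=
  (skipTwo_strictMono b).monotone.map_max

theorem skipTwo_mem_uIcc {b s t r : ℕ} :
    skipTwo b s ∈ Set.uIcc (skipTwo b t) (skipTwo b r) ↔ s ∈ Set.uIcc t r := by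
  simp only [Set.mem_uIcc, (skipTwo_strictMono b).le_iff_le]

theorem prodMap_skipTwo_injective (b : ℕ) :
    Function.Injective (Prod.map (skipTwo b) (skipTwo b)) :=
  (skipTwo_strictMono b).injective.prodMap (skipTwo_strictMono b).injective

theorem abs_skipTwo_sub_skipTwo {b s t : ℕ} (h : ¬(min s t ≤ b ∧ b < max s t)) :
    |(skipTwo b s : ℤ) - skipTwo b t| = |(s : ℤ) - t| := by
  unfold skipTwo
  rw [abs_eq_max_neg, abs_eq_max_neg]
  split_ifs <;> push_cast <;> omega

theorem units_coe_eq_one_or (d : ℤˣ) : (d : ℤ) = 1 ∨ (d : ℤ) = -1 := Int.isUnit_iff.1 d.isUnit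

/-- The path `T` makes a step in the direction `d` at time `b` and takes it back at once. -/
structure HasBacktrack (T : ℕ → ℤ) (b : ℕ) (d : ℤˣ) : Prop where
  step : T (b + 1) = T b + d
  back : T (b + 2) = T b

namespace HasBacktrack

variable {T : ℕ → ℤ} {b : ℕ} {d : ℤˣ} {x₁ x₂ : ℤ} {t s : ℕ × ℕ}

theorem isNearestNeighbor (hb : HasBacktrack T b d) (hT : IsNearestNeighbor T) :
    IsNearestNeighbor (T ∘ skipTwo b) := by
  intro k
  simp only [Function.comp_apply]
  rcases lt_trichotomy k b with hk | rfl | hk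
  · rw [skipTwo_of_le (by omega), skipTwo_of_le (by omega)]
    exact hT k
  · rw [skipTwo_of_lt (by omega), skipTwo_of_le le_rfl, ← hb.back]
    exact hT (k + 2)
  · rw [skipTwo_of_lt (by omega), skipTwo_of_lt (by omega)]
    exact hT (k + 2)

theorem exists_eq_skipTwo (hb : HasBacktrack T b d) {u : ℕ} (hu : T u ≠ T b ∧ T u ≠ T (b + 1)) :
    ∃ v, skipTwo b v = u := by
  refine exists_skipTwo_eq ?_ ?_
  · rintro rfl
    exact hu.2 rfl
  · rintro rfl
    exact hu.1 hb.back

theorem exists_of_isCrossing (hb : HasBacktrack T b d) (h₁ : x₁ ≠ T b ∧ x₁ ≠ T (b + 1))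
    (h₂ : x₂ ≠ T b ∧ x₂ ≠ T (b + 1)) (ht : IsCrossing T x₁ x₂ t) :
    ∃ t', Prod.map (skipTwo b) (skipTwo b) t' = t := by
  obtain ⟨u, hu⟩ := hb.exists_eq_skipTwo (u := t.1) (by rwa [ht.2.1])
  obtain ⟨v, hv⟩ := hb.exists_eq_skipTwo (u := t.2) (by rwa [ht.2.2.1])
  exact ⟨(u, v), Prod.ext hu hv⟩

theorem between_of_isCrossing_comp (hb : HasBacktrack T b d) (h₁ : x₁ ≠ T b ∧ x₁ ≠ T (b + 1))
    (h₂ : x₂ ≠ T b ∧ x₂ ≠ T (b + 1)) (ht : IsCrossing (T ∘ skipTwo b) x₁ x₂ t) {s : ℕ}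
    (hs : s = b + 1 ∨ s = b + 2) (hlo : skipTwo b (min t.1 t.2) < s)
    (hhi : s < skipTwo b (max t.1 t.2)) : min x₁ x₂ < T s ∧ T s < max x₁ x₂ := by
  obtain ⟨hle, hlt⟩ : min t.1 t.2 ≤ b ∧ b < max t.1 t.2 := by
    unfold skipTwo at hlo hhi
    split_ifs at hlo hhi <;> omega
  have hne : min t.1 t.2 ≠ b := by
    rintro hmin
    have hval := ht.apply_min
    rw [hmin, Function.comp_apply, skipTwo_of_le le_rfl] at hval
    exact hval.elim (fun h => h₁.1 h.symm) (fun h => h₂.1 h.symm)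
  have hbin := ht.2.2.2 b (lt_of_le_of_ne hle hne) hlt
  rw [Function.comp_apply, skipTwo_of_le le_rfl] at hbin
  have hstep := hb.step
  have hd := units_coe_eq_one_or d
  rcases hs with rfl | rfl
  · omega
  · rwa [hb.back]

theorem isCrossing_iff (hb : HasBacktrack T b d) (h₁ : x₁ ≠ T b ∧ x₁ ≠ T (b + 1))
    (h₂ : x₂ ≠ T b ∧ x₂ ≠ T (b + 1)) :
    IsCrossing (T ∘ skipTwo b) x₁ x₂ t ↔
      IsCrossing T x₁ x₂ (Prod.map (skipTwo b) (skipTwo b) t) := by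
  have hmono := skipTwo_strictMono b
  constructor
  · refine fun ht => ⟨ht.1, ht.2.1, ht.2.2.1, fun s hlo hhi => ?_⟩
    rw [Prod.map_fst, Prod.map_snd, ← skipTwo_min] at hlo
    rw [Prod.map_fst, Prod.map_snd, ← skipTwo_max] at hhi
    by_cases hs : s = b + 1 ∨ s = b + 2
    · exact hb.between_of_isCrossing_comp h₁ h₂ ht hs hlo hhi
    · obtain ⟨v, rfl⟩ := exists_skipTwo_eq (b := b) (u := s) (by omega) (by omega)
      exact ht.2.2.2 v (hmono.lt_iff_lt.1 hlo) (hmono.lt_iff_lt.1 hhi)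
  · refine fun ht => ⟨ht.1, ht.2.1, ht.2.2.1, fun s hlo hhi => ht.2.2.2 _ ?_ ?_⟩
    · rw [Prod.map_fst, Prod.map_snd, ← skipTwo_min]
      exact hmono hlo
    · rw [Prod.map_fst, Prod.map_snd, ← skipTwo_max]
      exact hmono hhi

theorem crossingsUpTo_eq_image (hb : HasBacktrack T b d) (h₁ : x₁ ≠ T b ∧ x₁ ≠ T (b + 1))
    (h₂ : x₂ ≠ T b ∧ x₂ ≠ T (b + 1)) (N : ℕ) :
    crossingsUpTo T x₁ x₂ (skipTwo b N) =
      Prod.map (skipTwo b) (skipTwo b) '' crossingsUpTo (T ∘ skipTwo b) x₁ x₂ N := by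
  have hle : ∀ s : ℕ × ℕ, max (Prod.map (skipTwo b) (skipTwo b) s).1
      (Prod.map (skipTwo b) (skipTwo b) s).2 ≤ skipTwo b N ↔ max s.1 s.2 ≤ N := fun s => by
    rw [Prod.map_fst, Prod.map_snd, ← skipTwo_max, (skipTwo_strictMono b).le_iff_le]
  ext s
  constructor
  · rintro ⟨hs, hsN⟩
    obtain ⟨s, rfl⟩ := hb.exists_of_isCrossing h₁ h₂ hs
    exact ⟨s, ⟨(hb.isCrossing_iff h₁ h₂).2 hs, (hle s).1 hsN⟩, rfl⟩
  · rintro ⟨s, ⟨hs, hsN⟩, rfl⟩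
    exact ⟨(hb.isCrossing_iff h₁ h₂).1 hs, (hle s).2 hsN⟩

theorem isNthCrossing_iff (hb : HasBacktrack T b d) (h₁ : x₁ ≠ T b ∧ x₁ ≠ T (b + 1))
    (h₂ : x₂ ≠ T b ∧ x₂ ≠ T (b + 1)) {i : ℕ} :
    IsNthCrossing (T ∘ skipTwo b) x₁ x₂ i t ↔
      IsNthCrossing T x₁ x₂ i (Prod.map (skipTwo b) (skipTwo b) t) := by
  unfold IsNthCrossing
  rw [hb.isCrossing_iff h₁ h₂, Prod.map_fst, Prod.map_snd, ← skipTwo_min, ← crossingsUpTo,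
    ← crossingsUpTo, hb.crossingsUpTo_eq_image h₁ h₂, (prodMap_skipTwo_injective b).encard_image]

theorem isFirstCrossingDuring_iff (hb : HasBacktrack T b d) (h₁ : x₁ ≠ T b ∧ x₁ ≠ T (b + 1))
    (h₂ : x₂ ≠ T b ∧ x₂ ≠ T (b + 1)) :
    IsFirstCrossingDuring (T ∘ skipTwo b) x₁ x₂ t s ↔
      IsFirstCrossingDuring T x₁ x₂ (Prod.map (skipTwo b) (skipTwo b) t)
        (Prod.map (skipTwo b) (skipTwo b) s) := by
  simp only [_root_.isFirstCrossingDuring_iff, Prod.map_fst, Prod.map_snd, skipTwo_mem_uIcc]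
  rw [hb.isCrossing_iff h₁ h₂]
  refine and_congr_right fun _ => and_congr_right fun _ => and_congr_right fun _ => ?_
  constructor
  · intro hfirst r hr hr₁ hr₂
    obtain ⟨r, rfl⟩ := hb.exists_of_isCrossing h₁ h₂ hr
    simp only [Prod.map_fst, Prod.map_snd, skipTwo_mem_uIcc] at *
    exact hfirst r ((hb.isCrossing_iff h₁ h₂).2 hr) hr₁ hr₂
  · intro hfirst r hr hr₁ hr₂
    simpa only [Prod.map_fst, Prod.map_snd, skipTwo_mem_uIcc, hr₁, hr₂, forall_const] using
      hfirst (Prod.map (skipTwo b) (skipTwo b) r) ((hb.isCrossing_iff h₁ h₂).1 hr)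

end HasBacktrack

/-! ### Loci -/

/-- The label of a locus: the locus is the first crossing of `(j₁, j₂)` during the `i`-th crossing
of `(k₁, k₂)`. -/
structure LocusLabel where
  k₁ : ℤ
  k₂ : ℤ
  i : ℕ
  j₁ : ℤ
  j₂ : ℤ

/-- `s` is the locus of `T` with label `l`. -/
def IsLocus (T : ℕ → ℤ) (l : LocusLabel) (s : ℕ × ℕ) : Prop :=
  ∃ t, IsNthCrossing T l.k₁ l.k₂ l.i t ∧ IsFirstCrossingDuring T l.j₁ l.j₂ t s

/-- The locus of `T` with label `l` exists and is a straight crossing. -/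
def IsStraightLocus (T : ℕ → ℤ) (l : LocusLabel) : Prop :=
  ∃ s, IsLocus T l s ∧ |(s.1 : ℤ) - s.2| = |l.j₁ - l.j₂|

namespace LocusLabel

/-- The labels whose loci exist in recurrent paths and cross an interval of length three, the only
length used here: a crossing of such an interval is straight or turns back after two steps. -/
structure IsAdmissible (l : LocusLabel) : Prop where
  pos : 0 < l.i
  ne : l.k₁ ≠ l.k₂
  length : |l.j₁ - l.j₂| = 3
  left_mem : l.j₁ ∈ Set.uIcc l.k₁ l.k₂
  right_mem : l.j₂ ∈ Set.uIcc l.k₁ l.k₂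

/-- The integers strictly between `j₁` and `j₂`. -/
def inner (l : LocusLabel) : Set ℤ := Set.Ioo (min l.j₁ l.j₂) (max l.j₁ l.j₂)

/-- The endpoints of the two intervals of a label. -/
def endpoints (l : LocusLabel) : Set ℤ := {l.k₁, l.k₂, l.j₁, l.j₂}

/-- Two labels are separated if no path can be inside both loci: the intervals `(j₁, j₂)` are
disjoint, or the labels differ in the number `i` only. -/
def Separated (l l' : LocusLabel) : Prop :=
  Disjoint l.inner l'.inner ∨ ∃ i ≠ l.i, l' = { l with i := i }

/-- The value at which a crossing of `{j₁, j₂}` in the direction `d` starts. -/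
def start (l : LocusLabel) (d : ℤˣ) : ℤ := if d = 1 then min l.j₁ l.j₂ else max l.j₁ l.j₂

theorem start_one (l : LocusLabel) : l.start 1 = min l.j₁ l.j₂ := rfl

theorem start_neg_one (l : LocusLabel) : l.start (-1) = max l.j₁ l.j₂ := rfl

theorem IsAdmissible.disjoint_inner_endpoints {l : LocusLabel} (hl : l.IsAdmissible) :
    Disjoint l.inner l.endpoints := by
  obtain ⟨-, -, -, h₁, h₂⟩ := hl
  rw [Set.mem_uIcc] at h₁ h₂
  rw [Set.disjoint_left]
  rintro x ⟨hlo, hhi⟩ (rfl | rfl | rfl | rfl) <;> omega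

theorem IsAdmissible.start_add_mem_inner {l : LocusLabel} (hl : l.IsAdmissible) (d : ℤˣ) :
    l.start d + d ∈ l.inner ∧ l.start d + d + d ∈ l.inner := by
  have hlen := hl.length
  rw [abs_eq_max_neg] at hlen
  rcases Int.units_eq_one_or d with rfl | rfl <;>
    simp only [start_one, start_neg_one, inner, Set.mem_Ioo, Units.val_one, Units.val_neg] <;>
    omega

end LocusLabel

theorem IsCrossing.abs_sub_le {T : ℕ → ℤ} (hT : IsNearestNeighbor T) {x₁ x₂ : ℤ} {s : ℕ × ℕ}
    (hs : IsCrossing T x₁ x₂ s) : |x₁ - x₂| ≤ |(s.1 : ℤ) - s.2| := by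
  simpa only [hs.2.1, hs.2.2.1] using hT.abs_sub_le s.1 s.2

namespace IsLocus

variable {T : ℕ → ℤ} {l : LocusLabel} {s r : ℕ × ℕ}

theorem unique (hs : IsLocus T l s) (hr : IsLocus T l r) : s = r := by
  obtain ⟨t, ht, hst⟩ := hs
  obtain ⟨t', ht', hrt'⟩ := hr
  obtain rfl := ht.unique ht'
  exact hst.unique hrt'

theorem isCrossing (hs : IsLocus T l s) : IsCrossing T l.j₁ l.j₂ s := by
  obtain ⟨t, -, hst⟩ := hs
  exact hst.1

theorem index_unique {i : ℕ} (hs : IsLocus T l s) (hs' : IsLocus T { l with i := i } s) :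
    i = l.i := by
  obtain ⟨t, ht, hsc, hs₁, hs₂, -⟩ := hs
  obtain ⟨t', ht', -, hs₁', hs₂', -⟩ := hs'
  have hlt := hsc.min_lt_max
  rw [Set.mem_uIcc] at hs₁ hs₂ hs₁' hs₂'
  obtain rfl := ht.1.eq_of_overlap ht'.1 (by omega) (by omega)
  exact ht'.index_unique ht

theorem min_add_three_le_max (hT : IsNearestNeighbor T) (hl : l.IsAdmissible)
    (hs : IsLocus T l s) : min s.1 s.2 + 3 ≤ max s.1 s.2 := by
  have hle := hs.isCrossing.abs_sub_le hT
  rw [hl.length, abs_eq_max_neg] at hle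
  omega

end IsLocus

theorem LocusLabel.IsAdmissible.exists_isLocus {T : ℕ → ℤ} {l : LocusLabel} (hl : l.IsAdmissible)
    (hT : IsNearestNeighbor T) (hrec : IsRecurrent T) : ∃ s, IsLocus T l s := by
  obtain ⟨t, ht⟩ := hT.exists_isNthCrossing hrec hl.ne (l.i - 1)
  rw [Nat.sub_add_cancel hl.pos] at ht
  have hne : l.j₁ ≠ l.j₂ := fun e => by simpa [e] using hl.length
  obtain ⟨s, hs⟩ := hT.exists_isFirstCrossingDuring (t := t) hne
    (by rw [ht.1.2.1, ht.1.2.2.1]; exact hl.left_mem)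
    (by rw [ht.1.2.1, ht.1.2.2.1]; exact hl.right_mem)
  exact ⟨s, t, ht, hs⟩

/-- The locus of `T` with label `l` exists, begins at time `a` and is crossed in the direction
`d`. -/
def LocusBegins (T : ℕ → ℤ) (l : LocusLabel) (a : ℕ) (d : ℤˣ) : Prop :=
  T a = l.start d ∧ ∃ s, IsLocus T l s ∧ min s.1 s.2 = a

theorem IsLocus.exists_locusBegins {T : ℕ → ℤ} {l : LocusLabel} {s : ℕ × ℕ}
    (hs : IsLocus T l s) : ∃ a d, LocusBegins T l a d := by
  have hval := hs.isCrossing.apply_min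
  by_cases hmin : T (min s.1 s.2) = min l.j₁ l.j₂
  · exact ⟨_, 1, hmin, s, hs, rfl⟩
  · exact ⟨_, -1, by rw [LocusLabel.start_neg_one]; omega, s, hs, rfl⟩

namespace LocusBegins

variable {T : ℕ → ℤ} {l l' : LocusLabel} {a b : ℕ} {d e : ℤˣ} {s : ℕ × ℕ}

theorem unique (hl : l.IsAdmissible) (ha : LocusBegins T l a d) (hb : LocusBegins T l b e) :
    a = b ∧ d = e := by
  obtain ⟨hd, s, hs, rfl⟩ := ha
  obtain ⟨he, r, hr, rfl⟩ := hb
  obtain rfl := hs.unique hr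
  have hstart := hd.symm.trans he
  have hlen := hl.length
  rw [abs_eq_max_neg] at hlen
  rcases Int.units_eq_one_or d with rfl | rfl <;> rcases Int.units_eq_one_or e with rfl | rfl
  · exact ⟨rfl, rfl⟩
  · rw [LocusLabel.start_one, LocusLabel.start_neg_one] at hstart
    omega
  · rw [LocusLabel.start_one, LocusLabel.start_neg_one] at hstart
    omega
  · exact ⟨rfl, rfl⟩

theorem apply_add_one (hT : IsNearestNeighbor T) (hl : l.IsAdmissible)
    (ha : LocusBegins T l a d) : T (a + 1) = l.start d + d := by
  obtain ⟨hstart, s, hs, rfl⟩ := ha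
  have hlong := hs.min_add_three_le_max hT hl
  have hin := hs.isCrossing.2.2.2 (min s.1 s.2 + 1) (by omega) (by omega)
  have hstep := hT (min s.1 s.2)
  rcases Int.units_eq_one_or d with rfl | rfl <;>
    simp only [LocusLabel.start_one, LocusLabel.start_neg_one, Units.val_one, Units.val_neg]
      at hstart ⊢ <;> omega

theorem hasBacktrack (hT : IsNearestNeighbor T) (hl : l.IsAdmissible)
    (ha : LocusBegins T l a d) (hstraight : ¬ IsStraightLocus T l) :
    HasBacktrack T (a + 1) d := by
  have hone := ha.apply_add_one hT hl
  obtain ⟨hstart, s, hs, rfl⟩ := ha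
  have hne : |(s.1 : ℤ) - s.2| ≠ |l.j₁ - l.j₂| := fun h => hstraight ⟨s, hs, h⟩
  have hlong := hs.min_add_three_le_max hT hl
  have hlen := hl.length
  rw [hlen, abs_eq_max_neg] at hne
  rw [abs_eq_max_neg] at hlen
  have htwo := hs.isCrossing.2.2.2 (min s.1 s.2 + 2) (by omega) (by omega)
  have hthree := hs.isCrossing.2.2.2 (min s.1 s.2 + 3) (by omega) (by omega)
  have hstep := hT (min s.1 s.2 + 1)
  have hstep' := hT (min s.1 s.2 + 2)
  rcases Int.units_eq_one_or d with rfl | rfl <;>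
    simp only [LocusLabel.start_one, LocusLabel.start_neg_one, Units.val_one, Units.val_neg]
      at hone <;>
    constructor <;> push_cast <;> ring_nf at * <;> omega

theorem not_mem_inside (hT : IsNearestNeighbor T) (hl : l.IsAdmissible)
    (hdisj : Disjoint l.inner l'.endpoints) (hsep : l.Separated l') (ha : LocusBegins T l a d)
    (hs : IsLocus T l' s) : ¬(min s.1 s.2 ≤ a + 1 ∧ a + 1 < max s.1 s.2) := by
  rintro ⟨hle, hlt⟩
  have hin : T (a + 1) ∈ l.inner := by
    rw [ha.apply_add_one hT hl]
    exact (hl.start_add_mem_inner d).1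
  have hne : min s.1 s.2 ≠ a + 1 := fun h => by
    refine Set.disjoint_left.1 hdisj hin ?_
    rw [← h]
    rcases hs.isCrossing.apply_min with h | h <;> simp [h, LocusLabel.endpoints]
  have hin' : T (a + 1) ∈ l'.inner := hs.isCrossing.2.2.2 _ (by omega) hlt
  rcases hsep with hinner | ⟨i, hi, rfl⟩
  · exact Set.disjoint_left.1 hinner hin hin'
  · obtain ⟨-, r, hr, rfl⟩ := ha
    have hlong := hr.min_add_three_le_max hT hl
    obtain rfl : r = s := hr.isCrossing.eq_of_overlap hs.isCrossing (by omega) (by omega)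
    exact hi (hr.index_unique hs)

end LocusBegins

namespace HasBacktrack

variable {T : ℕ → ℤ} {a b : ℕ} {d : ℤˣ} {l l' : LocusLabel} {s : ℕ × ℕ}

theorem isLocus_iff (hb : HasBacktrack T b d)
    (hne : ∀ x ∈ l.endpoints, x ≠ T b ∧ x ≠ T (b + 1)) :
    IsLocus (T ∘ skipTwo b) l s ↔ IsLocus T l (Prod.map (skipTwo b) (skipTwo b) s) := by
  simp only [LocusLabel.endpoints, Set.mem_insert_iff, Set.mem_singleton_iff, forall_eq_or_imp,
    forall_eq] at hne
  obtain ⟨hk₁, hk₂, hj₁, hj₂⟩ := hne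
  constructor
  · rintro ⟨t, ht, hs⟩
    exact ⟨_, (hb.isNthCrossing_iff hk₁ hk₂).1 ht, (hb.isFirstCrossingDuring_iff hj₁ hj₂).1 hs⟩
  · rintro ⟨t, ht, hs⟩
    obtain ⟨t, rfl⟩ := hb.exists_of_isCrossing hk₁ hk₂ ht.1
    exact ⟨_, (hb.isNthCrossing_iff hk₁ hk₂).2 ht, (hb.isFirstCrossingDuring_iff hj₁ hj₂).2 hs⟩

theorem exists_of_isLocus (hb : HasBacktrack T b d)
    (hne : ∀ x ∈ l.endpoints, x ≠ T b ∧ x ≠ T (b + 1)) (hs : IsLocus T l s) :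
    ∃ s', Prod.map (skipTwo b) (skipTwo b) s' = s ∧ IsLocus (T ∘ skipTwo b) l s' := by
  obtain ⟨s', rfl⟩ := hb.exists_of_isCrossing (hne _ (by simp [LocusLabel.endpoints]))
    (hne _ (by simp [LocusLabel.endpoints])) hs.isCrossing
  exact ⟨s', rfl, (hb.isLocus_iff hne).2 hs⟩

theorem ne_of_mem_endpoints (hb : HasBacktrack T b d) (hl : l.IsAdmissible)
    (hTb : T b = l.start d + d) (hdisj : Disjoint l.inner l'.endpoints) :
    ∀ x ∈ l'.endpoints, x ≠ T b ∧ x ≠ T (b + 1) := by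
  obtain ⟨hmem, hmem'⟩ := hl.start_add_mem_inner d
  rw [← hTb] at hmem hmem'
  rw [← hb.step] at hmem'
  exact fun x hx => ⟨(hdisj.ne_of_mem hmem hx).symm, (hdisj.ne_of_mem hmem' hx).symm⟩

theorem locusBegins_of_comp (hT : IsNearestNeighbor T) (hl : l.IsAdmissible)
    (hb : HasBacktrack T (a + 1) d) (ha : LocusBegins (T ∘ skipTwo (a + 1)) l a d) :
    LocusBegins T l a d ∧ ¬ IsStraightLocus T l := by
  have hT' := hb.isNearestNeighbor hT
  have hone := ha.apply_add_one hT' hl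
  rw [Function.comp_apply, skipTwo_of_le le_rfl] at hone
  have hne := hb.ne_of_mem_endpoints hl hone hl.disjoint_inner_endpoints
  obtain ⟨hstart, s, hs, hsa⟩ := ha
  rw [Function.comp_apply, skipTwo_of_le (by omega)] at hstart
  have hs' := (hb.isLocus_iff hne).1 hs
  refine ⟨⟨hstart, _, hs', ?_⟩, ?_⟩
  · rw [Prod.map_fst, Prod.map_snd, ← skipTwo_min, hsa, skipTwo_of_le (by omega)]
  · rintro ⟨r, hr, hstraight⟩
    obtain rfl := hr.unique hs'
    have hlong := hs.min_add_three_le_max hT' hl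
    rw [hl.length, Prod.map_fst, Prod.map_snd, abs_eq_max_neg] at hstraight
    unfold skipTwo at hstraight
    split_ifs at hstraight <;> omega

theorem isStraightLocus_iff (hT : IsNearestNeighbor T) (hl : l.IsAdmissible)
    (hdisj : Disjoint l.inner l'.endpoints) (hsep : l.Separated l')
    (hb : HasBacktrack T (a + 1) d) (ha : LocusBegins (T ∘ skipTwo (a + 1)) l a d) :
    IsStraightLocus T l' ↔ IsStraightLocus (T ∘ skipTwo (a + 1)) l' := by
  have hT' := hb.isNearestNeighbor hT
  have hone := ha.apply_add_one hT' hl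
  rw [Function.comp_apply, skipTwo_of_le le_rfl] at hone
  have hne := hb.ne_of_mem_endpoints hl hone hdisj
  have hdur : ∀ s, IsLocus (T ∘ skipTwo (a + 1)) l' s →
      |(skipTwo (a + 1) s.1 : ℤ) - skipTwo (a + 1) s.2| = |(s.1 : ℤ) - s.2| := fun s hs =>
    abs_skipTwo_sub_skipTwo (ha.not_mem_inside hT' hl hdisj hsep hs)
  constructor
  · rintro ⟨s, hs, hstraight⟩
    obtain ⟨s, rfl, hs'⟩ := hb.exists_of_isLocus hne hs
    exact ⟨s, hs', by rw [← hdur s hs']; exact hstraight⟩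
  · rintro ⟨s, hs, hstraight⟩
    exact ⟨_, (hb.isLocus_iff hne).1 hs, by rw [Prod.map_fst, Prod.map_snd, hdur s hs, hstraight]⟩

end HasBacktrack

theorem IsNearestNeighbor.locusBegins_and_not_isStraightLocus_iff {T : ℕ → ℤ}
    (hT : IsNearestNeighbor T) {l : LocusLabel} (hl : l.IsAdmissible) {a : ℕ} {d : ℤˣ} :
    LocusBegins T l a d ∧ ¬ IsStraightLocus T l ↔
      HasBacktrack T (a + 1) d ∧ LocusBegins (T ∘ skipTwo (a + 1)) l a d := by
  refine ⟨fun ⟨ha, hstraight⟩ => ?_, fun ⟨hb, ha⟩ => hb.locusBegins_of_comp hT hl ha⟩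
  have hb := ha.hasBacktrack hT hl hstraight
  have hne := hb.ne_of_mem_endpoints hl (ha.apply_add_one hT hl) hl.disjoint_inner_endpoints
  obtain ⟨hstart, s, hs, hsa⟩ := ha
  obtain ⟨s, rfl, hs'⟩ := hb.exists_of_isLocus hne hs
  refine ⟨hb, by rwa [Function.comp_apply, skipTwo_of_le (by omega)], s, hs', ?_⟩
  rw [Prod.map_fst, Prod.map_snd, ← skipTwo_min] at hsa
  rw [← (skipTwo_strictMono (a + 1)).injective.eq_iff, hsa, skipTwo_of_le (by omega)]

/-! ### Measurability of properties of paths -/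

section Congr

variable {ι : Type*} [LinearOrder ι] {T T' : ι → ℤ} {x₁ x₂ : ℤ} {t : ι × ι}

theorem IsCrossing.congr (hT : Set.EqOn T T' (Set.uIcc t.1 t.2)) (ht : IsCrossing T x₁ x₂ t) :
    IsCrossing T' x₁ x₂ t := by
  refine ⟨ht.1, ?_, ?_, fun s hlo hhi => ?_⟩
  · rw [← hT Set.left_mem_uIcc, ht.2.1]
  · rw [← hT Set.right_mem_uIcc, ht.2.2.1]
  · rw [← hT ⟨hlo.le, hhi.le⟩]
    exact ht.2.2.2 s hlo hhi

theorem isCrossing_congr (hT : Set.EqOn T T' (Set.uIcc t.1 t.2)) :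
    IsCrossing T x₁ x₂ t ↔ IsCrossing T' x₁ x₂ t :=
  ⟨IsCrossing.congr hT, IsCrossing.congr hT.symm⟩

end Congr

theorem IsNthCrossing.congr {T T' : ℕ → ℤ} {x₁ x₂ : ℤ} {i : ℕ} {t : ℕ × ℕ}
    (hT : Set.EqOn T T' (Set.Iic (max t.1 t.2))) (ht : IsNthCrossing T x₁ x₂ i t) :
    IsNthCrossing T' x₁ x₂ i t := by
  refine ⟨ht.1.congr (hT.mono fun u hu => hu.2), ?_⟩
  rw [← ht.2]
  congr 2
  ext s
  exact and_congr_left fun hs => (isCrossing_congr (hT.mono fun u hu =>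
    hu.2.trans (hs.trans min_le_max))).symm

theorem IsFirstCrossingDuring.congr {T T' : ℕ → ℤ} {x₁ x₂ : ℤ} {t s : ℕ × ℕ}
    (hT : Set.EqOn T T' (Set.uIcc t.1 t.2)) (hs : IsFirstCrossingDuring T x₁ x₂ t s) :
    IsFirstCrossingDuring T' x₁ x₂ t s := by
  have hcrossing : ∀ r : ℕ × ℕ, r.1 ∈ Set.uIcc t.1 t.2 → r.2 ∈ Set.uIcc t.1 t.2 →
      (IsCrossing T x₁ x₂ r ↔ IsCrossing T' x₁ x₂ r) := fun r hr₁ hr₂ =>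
    isCrossing_congr (hT.mono (Set.uIcc_subset_uIcc hr₁ hr₂))
  obtain ⟨hsc, hs₁, hs₂, hfirst⟩ := hs
  exact ⟨(hcrossing s hs₁ hs₂).1 hsc, hs₁, hs₂, fun r hr hr₁ hr₂ =>
    hfirst r ((hcrossing r hr₁ hr₂).2 hr) hr₁ hr₂⟩

theorem measurableSet_of_exists_eqOn {Q : (ℕ → ℤ) → Prop}
    (hQ : ∀ T, Q T → ∃ N, ∀ T', Set.EqOn T T' (Set.Iic N) → Q T') :
    MeasurableSet {T | Q T} := by
  refine IsOpen.measurableSet (isOpen_iff_mem_nhds.2 fun T hT => ?_)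
  obtain ⟨N, hN⟩ := hQ T hT
  filter_upwards [set_pi_mem_nhds (Set.finite_Iic N) fun u _ =>
    (isOpen_discrete {T u}).mem_nhds rfl] with T' hT'
  exact hN T' fun u hu => (hT' u hu).symm

theorem measurableSet_isNthCrossing (x₁ x₂ : ℤ) (i : ℕ) (t : ℕ × ℕ) :
    MeasurableSet {T | IsNthCrossing T x₁ x₂ i t} :=
  measurableSet_of_exists_eqOn fun _ ht => ⟨_, fun _ hT => ht.congr hT⟩

theorem measurableSet_isFirstCrossingDuring (x₁ x₂ : ℤ) (t s : ℕ × ℕ) :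
    MeasurableSet {T | IsFirstCrossingDuring T x₁ x₂ t s} :=
  measurableSet_of_exists_eqOn fun _ hs =>
    ⟨max t.1 t.2, fun _ hT => hs.congr (hT.mono fun _ hu => hu.2)⟩

theorem measurableSet_isLocus (l : LocusLabel) (s : ℕ × ℕ) :
    MeasurableSet {T | IsLocus T l s} := by
  simp only [IsLocus, Set.ofPred_exists]
  exact MeasurableSet.iUnion fun t =>
    (measurableSet_isNthCrossing _ _ _ t).inter (measurableSet_isFirstCrossingDuring _ _ t s)

theorem measurableSet_isStraightLocus (l : LocusLabel) :
    MeasurableSet {T | IsStraightLocus T l} := by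
  simp only [IsStraightLocus, Set.ofPred_exists]
  exact MeasurableSet.iUnion fun s => (measurableSet_isLocus l s).inter (MeasurableSet.const _)

theorem measurableSet_locusBegins (l : LocusLabel) (a : ℕ) (d : ℤˣ) :
    MeasurableSet {T | LocusBegins T l a d} := by
  simp only [LocusBegins, Set.ofPred_and, Set.ofPred_exists]
  exact (measurable_pi_apply a (measurableSet_singleton _)).inter
    (MeasurableSet.iUnion fun s => (measurableSet_isLocus l s).inter (MeasurableSet.const _))

/-! ### Simple random walks -/

theorem indepFun_restrict_of_disjoint {Ω ι β : Type*} [MeasurableSpace Ω] [MeasurableSpace β]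
    {P : Measure Ω} {X : ι → Ω → β} (hX : iIndepFun X P) (hm : ∀ i, Measurable (X i))
    {A B : Set ι} (hAB : Disjoint A B) :
    IndepFun (fun ω (i : A) => X i ω) (fun ω (i : B) => X i ω) P := by
  rw [IndepFun_iff_Indep, MeasurableSpace.comap_process_pi, MeasurableSpace.comap_process_pi,
    iSup_subtype, iSup_subtype]
  exact indep_iSup_of_disjoint (fun i => (hm i).comap_le) hX hAB

section Martingale

variable {Ω : Type*} [MeasurableSpace Ω] {P : Measure Ω} [IsProbabilityMeasure P]

theorem martingale_sum_range_succ {X : ℕ → Ω → ℝ} (hX : iIndepFun X P)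
    (hm : ∀ k, StronglyMeasurable (X k)) (hint : ∀ k, Integrable (X k) P)
    (hmean : ∀ k, ∫ ω, X k ω ∂P = 0) :
    Martingale (fun k ω => ∑ i ∈ Finset.range (k + 1), X i ω) (Filtration.natural X hm) P := by
  refine martingale_of_condExp_sub_eq_zero_nat (fun k => ?_)
    (fun k => integrable_finsetSum _ fun i _ => hint i) fun k => ?_
  · exact Finset.stronglyMeasurable_fun_sum _ fun i hi =>
      (Filtration.stronglyAdapted_natural hm i).mono
        ((Filtration.natural X hm).mono (Nat.le_of_lt_succ (Finset.mem_range.1 hi)))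
  · have hdiff : (fun ω => ∑ i ∈ Finset.range (k + 1 + 1), X i ω) -
        (fun ω => ∑ i ∈ Finset.range (k + 1), X i ω) = X (k + 1) := by
      ext ω
      simp [Finset.sum_range_succ]
    rw [hdiff]
    filter_upwards [hX.condExp_natural_ae_eq_of_lt hm (Nat.lt_succ_self k)] with ω hω
    rw [hω, hmean, Pi.zero_apply]

theorem ae_not_bddAbove_of_abs_sub_eq_one {ℱ : Filtration ℕ ‹MeasurableSpace Ω›} {W : ℕ → Ω → ℝ}
    (hW : Martingale W ℱ P) (hstep : ∀ᵐ ω ∂P, ∀ k, |W (k + 1) ω - W k ω| = 1) :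
    ∀ᵐ ω ∂P, ¬ BddAbove (Set.range fun k => W k ω) := by
  have hbdd := hW.submartingale.bddAbove_iff_exists_tendsto (R := 1)
    (hstep.mono fun ω hω k => by simp [hω k])
  filter_upwards [hbdd, hstep] with ω hbdd hstep hrange
  obtain ⟨c, hc⟩ := hbdd.1 hrange
  have hlim := ((hc.comp (Filter.tendsto_add_atTop_nat 1)).sub hc).abs
  simp only [Function.comp_def, hstep, sub_self, abs_zero] at hlim
  exact one_ne_zero (tendsto_nhds_unique tendsto_const_nhds hlim)

end Martingale

/-- The path that starts at `0` and has the given steps. -/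
def pathOfSteps (x : ℕ → ℤ) (k : ℕ) : ℤ := ∑ i ∈ Finset.range k, x i

theorem pathOfSteps_sub {T : ℕ → ℤ} (h0 : T 0 = 0) :
    pathOfSteps (fun i => T (i + 1) - T i) = T := by
  funext k
  rw [pathOfSteps, Finset.sum_range_sub T, h0, sub_zero]

theorem measurable_pathOfSteps : Measurable pathOfSteps := by
  unfold pathOfSteps
  fun_prop

namespace IsSimpleRandomWalk

variable {Ω : Type*} [MeasurableSpace Ω] {P : Measure Ω} {S : ℕ → Ω → ℤ}

theorem measurable_step (hS : IsSimpleRandomWalk P S) (k : ℕ) :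
    Measurable fun ω => S (k + 1) ω - S k ω := (hS.measurable (k + 1)).sub (hS.measurable k)

theorem measurable_path (hS : IsSimpleRandomWalk P S) : Measurable fun ω k => S k ω :=
  measurable_pi_iff.2 hS.measurable

theorem measure_step (hS : IsSimpleRandomWalk P S) (k : ℕ) (d : ℤˣ) :
    P {ω | S (k + 1) ω - S k ω = d} = 1 / 2 := by
  rcases Int.units_eq_one_or d with rfl | rfl
  exacts [hS.step_right k, hS.step_left k]

theorem neg (hS : IsSimpleRandomWalk P S) : IsSimpleRandomWalk P fun k ω => -S k ω where
  measurable k := (hS.measurable k).neg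
  start := hS.start.mono fun ω hω => by rw [hω, neg_zero]
  indep := by
    convert hS.indep.comp (fun _ x => -x) fun _ => measurable_neg using 3
    simp only [Function.comp_apply]
    ring
  step_right k := by
    rw [← hS.step_left k]
    congr with ω
    omega
  step_left k := by
    rw [← hS.step_right k]
    congr with ω
    omega

theorem ae_pathOfSteps_eq (hS : IsSimpleRandomWalk P S) :
    ∀ᵐ ω ∂P, pathOfSteps (fun i => S (i + 1) ω - S i ω) = fun k => S k ω := by
  filter_upwards [hS.start] with ω hω
  exact pathOfSteps_sub (T := fun k => S k ω) hω

variable [IsProbabilityMeasure P]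

theorem ae_step_eq (hS : IsSimpleRandomWalk P S) (k : ℕ) :
    ∀ᵐ ω ∂P, S (k + 1) ω - S k ω = 1 ∨ S (k + 1) ω - S k ω = -1 := by
  have hm := hS.measurable_step k
  have hright : MeasurableSet {ω | S (k + 1) ω - S k ω = 1} := hm (measurableSet_singleton 1)
  have hleft : MeasurableSet {ω | S (k + 1) ω - S k ω = -1} := hm (measurableSet_singleton (-1))
  have hdisj : Disjoint {ω | S (k + 1) ω - S k ω = 1} {ω | S (k + 1) ω - S k ω = -1} := by
    refine Set.disjoint_left.2 fun ω h h' => ?_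
    rw [Set.mem_ofPred_eq] at h h'
    omega
  refine (mem_ae_iff_prob_eq_one (hright.union hleft)).2 ?_
  rw [measure_union hdisj hleft, hS.step_right, hS.step_left, ENNReal.add_halves]

theorem ae_isNearestNeighbor (hS : IsSimpleRandomWalk P S) :
    ∀ᵐ ω ∂P, IsNearestNeighbor fun k => S k ω := by
  filter_upwards [ae_all_iff.2 hS.ae_step_eq] with ω hω k
  exact (hω k).imp sub_eq_iff_eq_add'.1 sub_eq_iff_eq_add'.1

theorem map_step (hS : IsSimpleRandomWalk P S) (k : ℕ) :
    P.map (fun ω => S (k + 1) ω - S k ω) =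
      (1 / 2 : ENNReal) • (Measure.dirac 1 + Measure.dirac (-1)) := by
  refine Measure.ext_of_singleton fun x => ?_
  rw [Measure.map_apply (hS.measurable_step k) (measurableSet_singleton x), Measure.smul_apply,
    Measure.add_apply, smul_eq_mul, Measure.dirac_apply' _ (measurableSet_singleton x),
    Measure.dirac_apply' _ (measurableSet_singleton x)]
  by_cases hx : x = 1
  · subst hx
    exact (hS.step_right k).trans (by simp [Set.indicator])
  by_cases hx' : x = -1
  · subst hx'
    exact (hS.step_left k).trans (by simp [Set.indicator])
  · rw [measure_eq_zero_iff_ae_notMem.2]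
    · simp [Ne.symm hx, Ne.symm hx']
    · filter_upwards [hS.ae_step_eq k] with ω hω
      rw [Set.mem_preimage, Set.mem_singleton_iff]
      omega

theorem integrable_step (hS : IsSimpleRandomWalk P S) (k : ℕ) :
    Integrable (fun ω => ((S (k + 1) ω - S k ω : ℤ) : ℝ)) P := by
  refine Integrable.of_bound
    (measurable_from_top.comp (hS.measurable_step k)).aestronglyMeasurable 1 ?_
  filter_upwards [hS.ae_step_eq k] with ω hω
  rcases hω with h | h <;> simp [h]

theorem integral_step (hS : IsSimpleRandomWalk P S) (k : ℕ) :
    ∫ ω, ((S (k + 1) ω - S k ω : ℤ) : ℝ) ∂P = 0 := by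
  rw [← integral_map (f := fun x : ℤ => (x : ℝ)) (hS.measurable_step k).aemeasurable
      measurable_from_top.aestronglyMeasurable, hS.map_step k, integral_smul_measure,
    integral_add_measure (integrable_dirac (by simp)) (integrable_dirac (by simp)),
    integral_dirac, integral_dirac]
  simp

theorem ae_not_bddAbove (hS : IsSimpleRandomWalk P S) :
    ∀ᵐ ω ∂P, ∀ B : ℤ, ∃ k, B < S k ω := by
  have hm : ∀ k, StronglyMeasurable fun ω => ((S (k + 1) ω - S k ω : ℤ) : ℝ) := fun k =>
    (measurable_from_top.comp (hS.measurable_step k)).stronglyMeasurable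
  have hindep : iIndepFun (fun k ω => ((S (k + 1) ω - S k ω : ℤ) : ℝ)) P :=
    hS.indep.comp (fun _ x => (x : ℝ)) fun _ => measurable_from_top
  have hunbounded := ae_not_bddAbove_of_abs_sub_eq_one
    (martingale_sum_range_succ hindep hm hS.integrable_step hS.integral_step) <| by
      filter_upwards [ae_all_iff.2 hS.ae_step_eq] with ω hω k
      rw [Finset.sum_range_succ _ (k + 1), add_sub_cancel_left]
      rcases hω (k + 1) with h | h <;> simp [h]
  filter_upwards [hunbounded] with ω hω B
  by_contra! hB
  refine hω ⟨((B - S 0 ω : ℤ) : ℝ), ?_⟩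
  rintro _ ⟨k, rfl⟩
  dsimp only
  rw [← Int.cast_sum, Finset.sum_range_sub (fun k => S k ω)]
  exact Int.cast_le.2 (by linarith [hB (k + 1)])

theorem ae_isRecurrent (hS : IsSimpleRandomWalk P S) : ∀ᵐ ω ∂P, IsRecurrent fun k => S k ω := by
  filter_upwards [hS.ae_isNearestNeighbor, hS.ae_not_bddAbove, hS.neg.ae_not_bddAbove]
    with ω hn habove hbelow x N
  obtain ⟨b, hb⟩ := habove (|x| + |S 0 ω| + N)
  obtain ⟨c, hc⟩ := hbelow (|x| + |S 0 ω| + N)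
  have hb' := hn.abs_sub_le b 0
  have hc' := hn.abs_sub_le c 0
  have hx : x ∈ Set.uIcc (S b ω) (S c ω) := by
    simp only [Set.mem_uIcc, abs_eq_max_neg] at *
    omega
  obtain ⟨k, hk, hkx⟩ := hn.exists_eq (a := b) (b := c) hx
  refine ⟨k, ?_, hkx⟩
  simp only [Set.mem_uIcc, abs_eq_max_neg] at *
  push_cast at *
  omega

end IsSimpleRandomWalk

/-! ### Straight loci of a simple random walk -/

/-- The enumeration of the steps of a path that are left when the steps `b` and `b + 1` are
deleted. -/
def skipStep (b i : ℕ) : ℕ := if i < b then i else i + 2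

theorem skipStep_injective (b : ℕ) : Function.Injective (skipStep b) := fun i j h => by
  unfold skipStep at h
  split_ifs at h <;> omega

theorem skipStep_mem_compl (b i : ℕ) : skipStep b i ∈ ({b, b + 1}ᶜ : Set ℕ) := by
  simp only [Set.mem_compl_iff, Set.mem_insert_iff, Set.mem_singleton_iff]
  unfold skipStep
  split_ifs <;> omega

namespace HasBacktrack

variable {T : ℕ → ℤ} {b : ℕ} {d : ℤˣ}

theorem iff_steps : HasBacktrack T b d ↔ T (b + 1) - T b = d ∧ T (b + 1 + 1) - T (b + 1) = -d :=
  ⟨fun h => ⟨by rw [h.step]; ring, by rw [h.back, h.step]; ring⟩,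
    fun h => ⟨by linarith [h.1], by linarith [h.1, h.2]⟩⟩

theorem comp_skipTwo_eq (hb : HasBacktrack T b d) (h0 : T 0 = 0) :
    T ∘ skipTwo b = pathOfSteps fun i => T (skipStep b i + 1) - T (skipStep b i) := by
  have hback := hb.back
  funext k
  induction k with
  | zero => simp [pathOfSteps, skipTwo, h0]
  | succ k ih =>
    unfold pathOfSteps at ih ⊢
    rw [Finset.sum_range_succ, ← ih, Function.comp_apply, Function.comp_apply]
    rcases lt_trichotomy k b with hk | rfl | hk
    · rw [skipTwo_of_le (by omega), skipTwo_of_le (by omega), skipStep, if_pos (by omega)]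
      ring
    · rw [skipTwo_of_lt (by omega), skipTwo_of_le le_rfl, skipStep, if_neg (by omega), hback,
        add_right_comm k 1 2]
      ring
    · rw [skipTwo_of_lt (by omega), skipTwo_of_lt (by omega), skipStep, if_neg (by omega),
        add_right_comm k 1 2]
      ring

end HasBacktrack

theorem measure_eq_tsum_inter_of_ae_existsUnique {α ι : Type*} [MeasurableSpace α] [Countable ι]
    {μ : Measure α} {A : Set α} (hA : MeasurableSet A) {B : ι → Set α}
    (hB : ∀ i, MeasurableSet (B i)) (hex : ∀ᵐ x ∂μ, ∃! i, x ∈ B i) :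
    μ A = ∑' i, μ (A ∩ B i) := by
  have hdisj : Pairwise (Function.onFun (AEDisjoint μ) B) := fun i j hij =>
    measure_eq_zero_iff_ae_notMem.2 <| hex.mono fun x hx h => hij (hx.unique h.1 h.2)
  have hunion : ∀ᵐ x ∂μ, x ∈ ⋃ i, B i := hex.mono fun x hx => Set.mem_iUnion.2 hx.exists
  rw [← Measure.restrict_eq_self_of_ae_mem hunion,
    Measure.restrict_iUnion_apply_ae hdisj (fun i => (hB i).nullMeasurableSet) hA,
    Measure.restrict_eq_self_of_ae_mem hunion]
  simp only [Measure.restrict_apply hA]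

namespace IsSimpleRandomWalk

variable {Ω : Type*} [MeasurableSpace Ω] {P : Measure Ω} {S : ℕ → Ω → ℤ}

theorem indepFun_steps_pathOfSteps_skipStep (hS : IsSimpleRandomWalk P S) (b : ℕ) :
    IndepFun (fun ω => (S (b + 1) ω - S b ω, S (b + 1 + 1) ω - S (b + 1) ω))
      (fun ω => pathOfSteps fun i => S (skipStep b i + 1) ω - S (skipStep b i) ω) P := by
  have hpair : Measurable fun x : ({b, b + 1} : Set ℕ) → ℤ =>
      (x ⟨b, by simp⟩, x ⟨b + 1, by simp⟩) := by fun_prop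
  have hpath : Measurable fun x : ({b, b + 1}ᶜ : Set ℕ) → ℤ =>
      pathOfSteps fun i => x ⟨skipStep b i, skipStep_mem_compl b i⟩ :=
    measurable_pathOfSteps.comp (by fun_prop)
  exact (indepFun_restrict_of_disjoint hS.indep hS.measurable_step
    (disjoint_compl_right (a := ({b, b + 1} : Set ℕ)))).comp hpair hpath

theorem measure_hasBacktrack (hS : IsSimpleRandomWalk P S) (b : ℕ) (d : ℤˣ) :
    P {ω | HasBacktrack (fun k => S k ω) b d} = 1 / 4 := by
  have hprod := (hS.indep.indepFun (Nat.lt_succ_self b).ne).measure_inter_preimage_eq_mul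
    {(d : ℤ)} {((-d : ℤˣ) : ℤ)} (measurableSet_singleton _) (measurableSet_singleton _)
  simp only [HasBacktrack.iff_steps, Set.ofPred_and]
  refine hprod.trans ((congrArg₂ _ (hS.measure_step b d) (hS.measure_step (b + 1) (-d))).trans ?_)
  rw [one_div, ← ENNReal.mul_inv (by simp) (by simp), one_div]
  norm_num

variable [IsProbabilityMeasure P]

theorem map_pathOfSteps_comp (hS : IsSimpleRandomWalk P S) {f : ℕ → ℕ}
    (hf : Function.Injective f) :
    P.map (fun ω => pathOfSteps fun i => S (f i + 1) ω - S (f i) ω) = P.map fun ω k => S k ω := by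
  have hsteps : P.map (fun ω i => S (f i + 1) ω - S (f i) ω) =
      P.map fun ω i => S (i + 1) ω - S i ω := by
    rw [hS.indep.map_fun_eq_infinitePi_map hS.measurable_step]
    refine ((hS.indep.precomp hf).map_fun_eq_infinitePi_map
      fun i => hS.measurable_step (f i)).trans ?_
    congr with i
    rw [hS.map_step i, ← hS.map_step (f i)]
  calc P.map (fun ω => pathOfSteps fun i => S (f i + 1) ω - S (f i) ω)
      = (P.map fun ω i => S (f i + 1) ω - S (f i) ω).map pathOfSteps :=
        (Measure.map_map measurable_pathOfSteps
          (measurable_pi_iff.2 fun i => hS.measurable_step (f i))).symm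
    _ = P.map fun ω => pathOfSteps fun i => S (i + 1) ω - S i ω := by
        rw [hsteps, Measure.map_map measurable_pathOfSteps
          (measurable_pi_iff.2 hS.measurable_step)]
        rfl
    _ = P.map fun ω k => S k ω := Measure.map_congr hS.ae_pathOfSteps_eq

theorem measure_hasBacktrack_inter (hS : IsSimpleRandomWalk P S) (b : ℕ) (d : ℤˣ)
    {F : Set (ℕ → ℤ)} (hF : MeasurableSet F) :
    P {ω | HasBacktrack (fun k => S k ω) b d ∧ (fun k => S k ω) ∘ skipTwo b ∈ F} =
      1 / 4 * P {ω | (fun k => S k ω) ∈ F} := by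
  have hprod := (hS.indepFun_steps_pathOfSteps_skipStep b).measure_inter_preimage_eq_mul
    {((d : ℤ), -(d : ℤ))} F (measurableSet_singleton _) hF
  have hsteps : (fun ω => (S (b + 1) ω - S b ω, S (b + 1 + 1) ω - S (b + 1) ω)) ⁻¹'
      {((d : ℤ), -(d : ℤ))} = {ω | HasBacktrack (fun k => S k ω) b d} := by
    ext ω
    simp [HasBacktrack.iff_steps]
  have hpath := DFunLike.congr_fun (hS.map_pathOfSteps_comp (skipStep_injective b)) F
  have hm : Measurable fun ω => pathOfSteps fun i =>
      S (skipStep b i + 1) ω - S (skipStep b i) ω :=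
    measurable_pathOfSteps.comp (measurable_pi_iff.2 fun i => hS.measurable_step (skipStep b i))
  rw [Measure.map_apply hm hF, Measure.map_apply hS.measurable_path hF] at hpath
  rw [hsteps, hS.measure_hasBacktrack, hpath] at hprod
  refine (measure_congr ?_).trans hprod
  filter_upwards [hS.start] with ω hω
  refine propext (and_congr_right fun hb => ?_)
  rw [hb.comp_skipTwo_eq hω]
  rfl

theorem measure_eq_tsum_locusBegins (hS : IsSimpleRandomWalk P S) {l : LocusLabel}
    (hl : l.IsAdmissible) {A : Set (ℕ → ℤ)} (hA : MeasurableSet A) :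
    P {ω | (fun k => S k ω) ∈ A} =
      ∑' c : ℕ × ℤˣ, P {ω | (fun k => S k ω) ∈ A ∧ LocusBegins (fun k => S k ω) l c.1 c.2} := by
  refine measure_eq_tsum_inter_of_ae_existsUnique (hS.measurable_path hA)
    (fun c => hS.measurable_path (measurableSet_locusBegins l c.1 c.2)) ?_
  filter_upwards [hS.ae_isNearestNeighbor, hS.ae_isRecurrent] with ω hn hrec
  obtain ⟨s, hs⟩ := hl.exists_isLocus hn hrec
  obtain ⟨a, d, had⟩ := hs.exists_locusBegins
  exact ⟨(a, d), had, fun c (hc : LocusBegins _ l c.1 c.2) => Prod.ext_iff.2 (hc.unique hl had)⟩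

/-- The paths that begin a non-straight crossing with the step `d` at time `a` are exactly those
obtained by inserting a backtrack at time `a + 1`, which has probability `1 / 4`. -/
theorem measure_inter_not_isStraightLocus (hS : IsSimpleRandomWalk P S) {l : LocusLabel}
    (hl : l.IsAdmissible) {F : Set (ℕ → ℤ)} (hF : MeasurableSet F)
    (hskip : ∀ T a d, IsNearestNeighbor T → HasBacktrack T (a + 1) d →
      LocusBegins (T ∘ skipTwo (a + 1)) l a d → (T ∈ F ↔ T ∘ skipTwo (a + 1) ∈ F)) :
    P {ω | (fun k => S k ω) ∈ F ∧ ¬ IsStraightLocus (fun k => S k ω) l} =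
      1 / 4 * P {ω | (fun k => S k ω) ∈ F} := by
  have hG := (measurableSet_isStraightLocus l).compl
  refine (hS.measure_eq_tsum_locusBegins hl (hF.inter hG)).trans ?_
  rw [hS.measure_eq_tsum_locusBegins hl hF, ← ENNReal.tsum_mul_left]
  congr with c
  refine (measure_congr ?_).trans (hS.measure_hasBacktrack_inter (c.1 + 1) c.2
    (hF.inter (measurableSet_locusBegins l c.1 c.2)))
  filter_upwards [hS.ae_isNearestNeighbor] with ω hn
  have hiff := hn.locusBegins_and_not_isStraightLocus_iff hl (a := c.1) (d := c.2)
  refine propext ⟨fun ⟨⟨hmem, hnot⟩, ha⟩ => ?_, fun ⟨hb, hmem, ha⟩ => ?_⟩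
  · obtain ⟨hb, ha'⟩ := hiff.1 ⟨ha, hnot⟩
    exact ⟨hb, (hskip _ _ _ hn hb ha').1 hmem, ha'⟩
  · obtain ⟨ha', hnot⟩ := hiff.2 ⟨hb, ha⟩
    exact ⟨⟨(hskip _ _ _ hn hb ha).2 hmem, hnot⟩, ha'⟩

theorem measure_inter_isStraightLocus (hS : IsSimpleRandomWalk P S) {l : LocusLabel}
    (hl : l.IsAdmissible) {F : Set (ℕ → ℤ)} (hF : MeasurableSet F)
    (hskip : ∀ T a d, IsNearestNeighbor T → HasBacktrack T (a + 1) d →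
      LocusBegins (T ∘ skipTwo (a + 1)) l a d → (T ∈ F ↔ T ∘ skipTwo (a + 1) ∈ F)) :
    P {ω | (fun k => S k ω) ∈ F ∧ IsStraightLocus (fun k => S k ω) l} =
      3 / 4 * P {ω | (fun k => S k ω) ∈ F} := by
  have hadd := measure_inter_add_sdiff (μ := P) {ω | (fun k => S k ω) ∈ F}
    (hS.measurable_path (measurableSet_isStraightLocus l))
  have hnot := hS.measure_inter_not_isStraightLocus hl hF hskip
  have hsum : (3 / 4 + 1 / 4 : ENNReal) = 1 := by
    rw [ENNReal.div_add_div_same]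
    norm_num
    exact ENNReal.div_self (by simp) (by simp)
  refine (ENNReal.add_left_inj (a := 1 / 4 * P {ω | (fun k => S k ω) ∈ F})
    (ENNReal.mul_ne_top (by simp) (measure_ne_top _ _))).1 ?_
  rw [← add_mul, hsum, one_mul, ← hnot]
  exact hadd

theorem measure_forall_isStraightLocus (hS : IsSimpleRandomWalk P S) {β : Type*}
    {l : β → LocusLabel} {s : Finset β} (hl : ∀ b ∈ s, (l b).IsAdmissible)
    (hdisj : ∀ b ∈ s, ∀ c ∈ s, Disjoint (l b).inner (l c).endpoints)
    (hsep : (s : Set β).Pairwise fun b c => (l b).Separated (l c)) :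
    P {ω | ∀ b ∈ s, IsStraightLocus (fun k => S k ω) (l b)} = (3 / 4) ^ s.card := by
  classical
  induction s using Finset.induction_on with
  | empty => simp
  | insert b s hb ih =>
    have hF : MeasurableSet {T | ∀ c ∈ s, IsStraightLocus T (l c)} := by
      simp only [Set.ofPred_forall]
      exact Finset.measurableSet_biInter _ fun c _ => measurableSet_isStraightLocus (l c)
    have hlb := hl b (Finset.mem_insert_self b s)
    have hinter := hS.measure_inter_isStraightLocus hlb hF fun T a d hT hback ha =>
      forall₂_congr fun c hc => hback.isStraightLocus_iff hT hlb
        (hdisj b (Finset.mem_insert_self b s) c (Finset.mem_insert_of_mem hc))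
        (hsep (Finset.mem_insert_self b s) (Finset.mem_insert_of_mem hc)
          (ne_of_mem_of_not_mem hc hb).symm) ha
    rw [Finset.card_insert_of_notMem hb, pow_succ', ← ih
      (fun c hc => hl c (Finset.mem_insert_of_mem hc))
      (fun c hc e he => hdisj c (Finset.mem_insert_of_mem hc) e (Finset.mem_insert_of_mem he))
      (hsep.mono (Finset.coe_subset.2 (Finset.subset_insert b s)))]
    refine Eq.trans (congrArg P (Set.ext fun ω => ?_)) hinter
    simp only [Finset.mem_insert, forall_eq_or_imp, Set.mem_ofPred_eq, and_comm]

end IsSimpleRandomWalk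

/-! ### The representation of a fair scenery -/

theorem periodicScenery_add_one (c : Fin 2) (x : ℤ) : periodicScenery c (x + 1) =
    if x % 2 = 0 then periodicScenery c x else 1 - periodicScenery c x := by
  have hsub : 1 - (1 - c) = c := by revert c; decide
  unfold periodicScenery
  obtain h | h | h | h : x % 4 = 0 ∨ x % 4 = 1 ∨ x % 4 = 2 ∨ x % 4 = 3 := by omega
  · rw [if_pos (by omega), if_pos (by omega), if_pos (by omega)]
  · rw [if_neg (by omega), if_neg (by omega), if_pos (by omega)]
  · rw [if_neg (by omega), if_pos (by omega), if_neg (by omega)]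
  · rw [if_pos (by omega), if_neg (by omega), if_neg (by omega), hsub]

theorem sceneryWalk_zero (ξ : ℤ → Fin 2) : sceneryWalk ξ 0 = 0 :=
  ((eq_sceneryWalk_iff ξ _).2 rfl).2.1

theorem sceneryWalk_step (ξ : ℤ → Fin 2) (k : ℤ) :
    sceneryWalk ξ (k + 1) - sceneryWalk ξ k = 1 ∨ sceneryWalk ξ (k + 1) - sceneryWalk ξ k = -1 :=
  (abs_eq one_pos.le).1 (((eq_sceneryWalk_iff ξ _).2 rfl).1 k)

theorem sceneryWalk_emod_two (ξ : ℤ → Fin 2) (k : ℤ) : sceneryWalk ξ k % 2 = k % 2 := by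
  induction k using Int.induction_on with
  | zero => rw [sceneryWalk_zero]
  | succ k ih =>
    have := sceneryWalk_step ξ k
    omega
  | pred k ih =>
    have := sceneryWalk_step ξ (-(k : ℤ) - 1)
    rw [sub_add_cancel] at this
    omega

theorem sceneryWalk_step_eq_one_iff (ξ : ℤ → Fin 2) (k : ℤ) :
    sceneryWalk ξ (k + 1) - sceneryWalk ξ k = 1 ↔
      ξ (k + 1) = if k % 2 = 0 then ξ k else 1 - ξ k := by
  obtain ⟨-, -, hcol⟩ := (eq_sceneryWalk_iff ξ _).2 rfl
  rw [← hcol (k + 1), ← hcol k, ← sceneryWalk_emod_two ξ k, ← periodicScenery_add_one]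
  refine ⟨fun h => by rw [sub_eq_iff_eq_add'.1 h], fun h => ?_⟩
  by_contra hone
  have hdown : sceneryWalk ξ (k + 1) = sceneryWalk ξ k - 1 := by
    linarith [(sceneryWalk_step ξ k).resolve_left hone]
  have hflip := periodicScenery_step (ξ 0) (periodicScenery (ξ 0) (sceneryWalk ξ k + 1))
    (sceneryWalk ξ k)
  rw [← hdown] at hflip
  tauto

theorem sceneryWalk_comp_neg (ξ : ℤ → Fin 2) (k : ℤ) :
    sceneryWalk (fun j => ξ (-j)) k = sceneryWalk ξ (-k) := by
  rcases lt_trichotomy k 0 with hk | rfl | hk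
  · rw [sceneryWalk, sceneryWalk, if_neg (by omega), if_pos (by omega), Int.natAbs_neg]
    simp only [neg_neg]
  · simp only [neg_zero, sceneryWalk_zero]
  · rw [sceneryWalk, sceneryWalk, if_pos (by omega), if_neg (by omega), Int.natAbs_neg]

theorem measurable_halfSceneryWalk (k : ℕ) : Measurable fun ξ => halfSceneryWalk ξ k := by
  induction k with
  | zero => exact measurable_const
  | succ k ih =>
    let next : Fin 2 × Fin 2 × ℤ → ℤ := fun p =>
      if periodicScenery p.1 (p.2.2 + 1) = p.2.1 then p.2.2 + 1 else p.2.2 - 1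
    exact (measurable_of_countable next).comp
      ((measurable_pi_apply 0).prodMk ((measurable_pi_apply (k + 1 : ℤ)).prodMk ih))

theorem measurable_sceneryWalk : Measurable sceneryWalk := by
  refine measurable_pi_iff.2 fun k => ?_
  unfold sceneryWalk
  split_ifs
  · exact measurable_halfSceneryWalk _
  · exact (measurable_halfSceneryWalk _).comp (by fun_prop)

theorem measure_inter_eq_comp_of_indepFun {Ω β γ : Type*} [MeasurableSpace Ω] [MeasurableSpace β]
    [MeasurableSpace γ] [MeasurableSingletonClass γ] [Countable γ] {P : Measure Ω} {X : Ω → β}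
    {Y : Ω → γ} (hXY : IndepFun X Y P) (hX : Measurable X) (hY : Measurable Y) {p : ENNReal}
    (hp : ∀ y, P {ω | Y ω = y} = p) {f : β → γ} (hf : Measurable f) {A : Set β}
    (hA : MeasurableSet A) : P {ω | X ω ∈ A ∧ Y ω = f (X ω)} = P {ω | X ω ∈ A} * p := by
  have hpart : ∀ E, MeasurableSet E → P E = ∑' y, P (E ∩ {ω | f (X ω) = y}) := fun E hE =>
    measure_eq_tsum_inter_of_ae_existsUnique hE
      (fun y => hf.comp hX (measurableSet_singleton y)) (.of_forall fun ω => existsUnique_eq')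
  rw [hpart {ω | X ω ∈ A ∧ Y ω = f (X ω)}
      ((hX hA).inter (measurableSet_eq_fun hY (hf.comp hX))),
    hpart {ω | X ω ∈ A} (hX hA), ← ENNReal.tsum_mul_right]
  congr with y
  rw [← hp y]
  refine Eq.trans (congrArg P (Set.ext fun ω => ?_)) (hXY.measure_inter_preimage_eq_mul
    (A ∩ f ⁻¹' {y}) {y} (hA.inter (hf (measurableSet_singleton y))) (measurableSet_singleton y))
  simp only [Set.mem_inter_iff, Set.mem_ofPred_eq, Set.mem_preimage, Set.mem_singleton_iff]
  exact ⟨fun ⟨⟨hA, hY⟩, hy⟩ => ⟨⟨hA, hy⟩, hY.trans hy⟩,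
    fun ⟨⟨hA, hy⟩, hY⟩ => ⟨⟨hA, hY.trans hy.symm⟩, hy⟩⟩

/-- The half of the path `R` that is indexed by `0, ε, 2ε, …`. -/
def halfPath (R : ℤ → ℤ) (ε : ℤˣ) (k : ℕ) : ℤ := R (ε * k)

theorem measurable_halfPath (ε : ℤˣ) : Measurable fun R => halfPath R ε := by
  unfold halfPath
  fun_prop

namespace IsFairScenery

variable {Ω : Type*} [MeasurableSpace Ω] {P : Measure Ω} {ξ : ℤ → Ω → Fin 2}

theorem comp_neg (hξ : IsFairScenery P ξ) : IsFairScenery P fun k => ξ (-k) where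
  measurable k := hξ.measurable (-k)
  indep := hξ.indep.precomp neg_injective
  fair k := hξ.fair (-k)

theorem measurable_sceneryWalk (hξ : IsFairScenery P ξ) :
    Measurable fun ω => sceneryWalk fun k => ξ k ω :=
  _root_.measurable_sceneryWalk.comp (measurable_pi_iff.2 hξ.measurable)

theorem measurable_step (hξ : IsFairScenery P ξ) (k : ℤ) :
    Measurable fun ω => sceneryWalk (fun k => ξ k ω) (k + 1) - sceneryWalk (fun k => ξ k ω) k :=
  (measurable_pi_iff.1 hξ.measurable_sceneryWalk (k + 1)).sub
    (measurable_pi_iff.1 hξ.measurable_sceneryWalk k)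

theorem measurableSet_step_eq_one (hξ : IsFairScenery P ξ) (k : ℤ) : MeasurableSet
    {ω | sceneryWalk (fun k => ξ k ω) (k + 1) - sceneryWalk (fun k => ξ k ω) k = 1} :=
  hξ.measurable_step k (measurableSet_singleton 1)

theorem indepFun_stopped (hξ : IsFairScenery P ξ) (k : ℤ) :
    IndepFun (fun ω j => ξ (min j k) ω) (ξ (k + 1)) P := by
  have hdisj : Disjoint (Set.Iic k) {k + 1} := by simp
  exact (indepFun_restrict_of_disjoint hξ.indep hξ.measurable hdisj).comp
    (φ := fun x (j : ℤ) => x ⟨min j k, min_le_right j k⟩) (ψ := fun x => x ⟨k + 1, rfl⟩)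
    (by fun_prop) (measurable_pi_apply (⟨k + 1, rfl⟩ : ({k + 1} : Set ℤ)))

variable [IsProbabilityMeasure P]

/-- Given the colours up to `k`, exactly one value of the fair colour at `k + 1` makes the step at
`k` go up. -/
theorem measure_forall_step_eq_one (hξ : IsFairScenery P ξ) (s : Finset ℤ) :
    P {ω | ∀ k ∈ s, sceneryWalk (fun k => ξ k ω) (k + 1) - sceneryWalk (fun k => ξ k ω) k = 1} =
      (1 / 2) ^ s.card := by
  simp only [sceneryWalk_step_eq_one_iff]
  induction s using Finset.induction_on_max with
  | empty => simp
  | insert k s hs ih =>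
    let colour : ℤ → (ℤ → Fin 2) → Fin 2 := fun j x => if j % 2 = 0 then x j else 1 - x j
    have hcolour : ∀ j, Measurable (colour j) := fun j =>
      (measurable_of_countable fun c : Fin 2 => if j % 2 = 0 then c else 1 - c).comp
        (measurable_pi_apply j)
    have hA : MeasurableSet {x : ℤ → Fin 2 | ∀ j ∈ s, x (j + 1) = colour j x} := by
      simp only [Set.ofPred_forall]
      exact Finset.measurableSet_biInter _ fun j _ =>
        measurableSet_eq_fun (measurable_pi_apply _) (hcolour j)
    have hstopped := measure_inter_eq_comp_of_indepFun (hξ.indepFun_stopped k)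
      (measurable_pi_iff.2 fun j => hξ.measurable _) (hξ.measurable (k + 1)) (hξ.fair (k + 1))
      (hcolour k) hA
    have hmin : ∀ j ∈ s, min (j + 1) k = j + 1 ∧ min j k = j := fun j hj => by
      have := hs j hj
      omega
    have hpast : ∀ ω, (∀ j ∈ s, ξ (min (j + 1) k) ω = colour j fun j => ξ (min j k) ω) ↔
        ∀ j ∈ s, ξ (j + 1) ω = if j % 2 = 0 then ξ j ω else 1 - ξ j ω := fun ω =>
      forall₂_congr fun j hj => by simp only [colour, (hmin j hj).1, (hmin j hj).2]
    rw [Finset.card_insert_of_notMem fun h => lt_irrefl _ (hs k h), pow_succ, ← ih]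
    simp only [Set.mem_ofPred_eq, hpast] at hstopped
    refine Eq.trans (congrArg P (Set.ext fun ω => ?_)) hstopped
    simp only [Finset.mem_insert, forall_eq_or_imp, Set.mem_ofPred_eq, colour, min_self, and_comm]

theorem measure_step_eq_one (hξ : IsFairScenery P ξ) (k : ℤ) :
    P {ω | sceneryWalk (fun k => ξ k ω) (k + 1) - sceneryWalk (fun k => ξ k ω) k = 1} = 1 / 2 := by
  simpa using hξ.measure_forall_step_eq_one {k}

theorem measure_step_eq_neg_one (hξ : IsFairScenery P ξ) (k : ℤ) :
    P {ω | sceneryWalk (fun k => ξ k ω) (k + 1) - sceneryWalk (fun k => ξ k ω) k = -1} =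
      1 / 2 := by
  have hcompl : {ω | sceneryWalk (fun k => ξ k ω) (k + 1) - sceneryWalk (fun k => ξ k ω) k = -1} =
      {ω | sceneryWalk (fun k => ξ k ω) (k + 1) - sceneryWalk (fun k => ξ k ω) k = 1}ᶜ := by
    ext ω
    have := sceneryWalk_step (fun k => ξ k ω) k
    simp only [Set.mem_compl_iff, Set.mem_ofPred_eq]
    omega
  rw [hcompl, prob_compl_eq_one_sub (hξ.measurableSet_step_eq_one k),
    hξ.measure_step_eq_one, one_div, ENNReal.one_sub_inv_two]

theorem iIndepFun_step (hξ : IsFairScenery P ξ) :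
    iIndepFun (fun (k : ℤ) ω =>
      sceneryWalk (fun k => ξ k ω) (k + 1) - sceneryWalk (fun k => ξ k ω) k) P := by
  have hset : iIndepSet (fun k => {ω | sceneryWalk (fun k => ξ k ω) (k + 1) -
      sceneryWalk (fun k => ξ k ω) k = 1}) P := by
    rw [iIndepSet_iff_meas_biInter hξ.measurableSet_step_eq_one]
    intro s
    simp only [← Set.ofPred_forall, hξ.measure_forall_step_eq_one, hξ.measure_step_eq_one,
      Finset.prod_const]
  convert (hset.iIndepFun_indicator (β := ℤ)).comp (fun _ x => 2 * x - 1)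
    fun _ => measurable_from_top using 2 with k
  ext ω
  rcases sceneryWalk_step (fun k => ξ k ω) k with h | h <;> simp [Set.indicator, h]

theorem isSimpleRandomWalk_sceneryWalk (hξ : IsFairScenery P ξ) :
    IsSimpleRandomWalk P fun (k : ℕ) ω => sceneryWalk (fun k => ξ k ω) k where
  measurable k := measurable_pi_iff.1 hξ.measurable_sceneryWalk k
  start := .of_forall fun _ => sceneryWalk_zero _
  indep := mod_cast hξ.iIndepFun_step.precomp (g := fun k : ℕ => (k : ℤ)) Nat.cast_injective
  step_right k := mod_cast hξ.measure_step_eq_one k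
  step_left k := mod_cast hξ.measure_step_eq_neg_one k

theorem isSimpleRandomWalk_halfPath (hξ : IsFairScenery P ξ) (ε : ℤˣ) :
    IsSimpleRandomWalk P fun k ω => halfPath (sceneryWalk fun k => ξ k ω) ε k := by
  rcases Int.units_eq_one_or ε with rfl | rfl
  · simpa only [halfPath, Units.val_one, one_mul] using hξ.isSimpleRandomWalk_sceneryWalk
  · simpa only [halfPath, Units.val_neg, Units.val_one, neg_one_mul,
      fun ω => sceneryWalk_comp_neg fun k => ξ k ω] using
      hξ.comp_neg.isSimpleRandomWalk_sceneryWalk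

theorem indepFun_halfPath (hξ : IsFairScenery P ξ) :
    IndepFun (fun ω => halfPath (sceneryWalk fun k => ξ k ω) 1)
      (fun ω => halfPath (sceneryWalk fun k => ξ k ω) (-1)) P := by
  have hpos : ∀ i : ℕ, (i : ℤ) ∈ Set.Ici (0 : ℤ) := fun i => Int.natCast_nonneg i
  have hneg : ∀ i : ℕ, -(i : ℤ) - 1 ∈ (Set.Ici (0 : ℤ))ᶜ := fun i => by
    rw [Set.mem_compl_iff, Set.mem_Ici]
    omega
  have hpathPos : Measurable fun x : Set.Ici (0 : ℤ) → ℤ => pathOfSteps fun i => x ⟨i, hpos i⟩ :=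
    measurable_pathOfSteps.comp (by fun_prop)
  have hpathNeg : Measurable fun x : ((Set.Ici (0 : ℤ))ᶜ : Set ℤ) → ℤ =>
      pathOfSteps fun i => -x ⟨-i - 1, hneg i⟩ := measurable_pathOfSteps.comp (by fun_prop)
  have hzero : ∀ ε ω, halfPath (sceneryWalk fun k => ξ k ω) ε 0 = 0 := fun ε ω => by
    simp only [halfPath, Nat.cast_zero, mul_zero, sceneryWalk_zero]
  convert (indepFun_restrict_of_disjoint hξ.iIndepFun_step hξ.measurable_step
    disjoint_compl_right).comp hpathPos hpathNeg using 1 <;>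
  · funext ω
    rw [← pathOfSteps_sub (hzero _ ω)]
    simp [halfPath, add_comm, sub_eq_add_neg]

end IsFairScenery

/-! ### The crossings by a two-sided path -/

/-- The sign of `z` as a unit, with the junk value `1` at `z = 0`: the `z`-th crossing lies on the
half `signUnit z` of the path. -/
def signUnit (z : ℤ) : ℤˣ := if z < 0 then -1 else 1

theorem signUnit_mul_natAbs (z : ℤ) : signUnit z * (z.natAbs : ℤ) = z := by
  unfold signUnit
  split_ifs <;> simp only [Units.val_neg, Units.val_one] <;> omega

/-- The times of the two-sided path which correspond to the times `t` of its half `ε`. -/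
def signedTimes (ε : ℤˣ) (t : ℕ × ℕ) : ℤ × ℤ := (ε * t.1, ε * t.2)

section SignedTimes

variable {R : ℤ → ℤ} {x₁ x₂ z : ℤ} {ε : ℤˣ} {k : ℤ × ℤ} {t : ℕ × ℕ}

theorem signedTimes_injective (ε : ℤˣ) : Function.Injective (signedTimes ε) := fun s t h => by
  simp only [signedTimes, Prod.mk.injEq, Units.mul_right_inj, Nat.cast_inj] at h
  exact Prod.ext h.1 h.2

theorem exists_signedTimes_eq (h₁ : 0 ≤ ε * k.1) (h₂ : 0 ≤ ε * k.2) :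
    ∃ t, signedTimes ε t = k := by
  refine ⟨((ε * k.1).toNat, (ε * k.2).toNat), ?_⟩
  simp only [signedTimes, Int.toNat_of_nonneg h₁, Int.toNat_of_nonneg h₂, ← mul_assoc,
    ← Units.val_mul, Int.units_mul_self, Units.val_one, one_mul]

theorem units_mul_signedTimes_fst (ε : ℤˣ) (t : ℕ × ℕ) : ε * (signedTimes ε t).1 = t.1 := by
  simp only [signedTimes, ← mul_assoc, ← Units.val_mul, Int.units_mul_self, Units.val_one, one_mul]

theorem units_mul_signedTimes_snd (ε : ℤˣ) (t : ℕ × ℕ) : ε * (signedTimes ε t).2 = t.2 := by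
  simp only [signedTimes, ← mul_assoc, ← Units.val_mul, Int.units_mul_self, Units.val_one, one_mul]

theorem isCrossing_signedTimes_iff :
    IsCrossing R x₁ x₂ (signedTimes ε t) ↔ IsCrossing (halfPath R ε) x₁ x₂ t := by
  refine and_congr_right fun _ => and_congr_right fun _ => and_congr_right fun _ =>
    ⟨fun h u hlo hhi => h (ε * u) ?_ ?_, fun h s hlo hhi => ?_⟩
  on_goal 3 =>
    obtain ⟨u, rfl⟩ : ∃ u : ℕ, s = ε * u := by
      rcases Int.units_eq_one_or ε with rfl | rfl <;>
        simp only [signedTimes, Units.val_one, Units.val_neg] at hlo hhi ⊢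
      exacts [⟨s.toNat, by omega⟩, ⟨(-s).toNat, by omega⟩]
    refine h u ?_ ?_
  all_goals
    rcases Int.units_eq_one_or ε with rfl | rfl <;>
      simp only [signedTimes, Units.val_one, Units.val_neg] at * <;> omega

theorem isSignedCrossing_iff_units_mul (hz : z ≠ 0) :
    IsSignedCrossing R x₁ x₂ z k ↔
      IsCrossing R x₁ x₂ k ∧ 0 ≤ signUnit z * k.1 ∧ 0 ≤ signUnit z * k.2 ∧
        {s : ℤ × ℤ | IsCrossing R x₁ x₂ s ∧ 0 ≤ min (signUnit z * s.1) (signUnit z * s.2) ∧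
          max (signUnit z * s.1) (signUnit z * s.2) ≤
            min (signUnit z * k.1) (signUnit z * k.2)}.encard + 1 = z.natAbs := by
  refine and_congr_right fun _ => ?_
  rcases hz.lt_or_gt with hz | hz
  · have hset : {s : ℤ × ℤ | IsCrossing R x₁ x₂ s ∧ max s.1 s.2 ≤ 0 ∧
        max k.1 k.2 ≤ min s.1 s.2} = {s : ℤ × ℤ | IsCrossing R x₁ x₂ s ∧ 0 ≤ min (-s.1) (-s.2) ∧
          max (-s.1) (-s.2) ≤ min (-k.1) (-k.2)} := by
      ext s
      exact and_congr_right fun _ => by omega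
    simp only [signUnit, hz, hz.not_gt, hset, if_true, Units.val_neg, Units.val_one, neg_one_mul,
      false_and, true_and, false_or, Left.nonneg_neg_iff]
  · simp only [signUnit, hz, hz.not_gt, if_false, Units.val_one, one_mul, false_and, true_and,
      or_false]

theorem image_signedTimes_crossingsUpTo (N : ℕ) :
    signedTimes ε '' crossingsUpTo (halfPath R ε) x₁ x₂ N =
      {s | IsCrossing R x₁ x₂ s ∧ 0 ≤ min (ε * s.1 : ℤ) (ε * s.2) ∧
        max (ε * s.1 : ℤ) (ε * s.2) ≤ N} := by
  ext s
  constructor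
  · rintro ⟨t, ⟨ht, hN⟩, rfl⟩
    refine ⟨isCrossing_signedTimes_iff.2 ht, ?_⟩
    rw [units_mul_signedTimes_fst, units_mul_signedTimes_snd]
    omega
  · rintro ⟨hs, hpos, hN⟩
    obtain ⟨t, rfl⟩ := exists_signedTimes_eq (le_min_iff.1 hpos).1 (le_min_iff.1 hpos).2
    rw [units_mul_signedTimes_fst, units_mul_signedTimes_snd] at hN
    exact ⟨t, ⟨isCrossing_signedTimes_iff.1 hs, by omega⟩, rfl⟩

theorem isSignedCrossing_signedTimes_iff (hz : z ≠ 0) :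
    IsSignedCrossing R x₁ x₂ z (signedTimes (signUnit z) t) ↔
      IsNthCrossing (halfPath R (signUnit z)) x₁ x₂ z.natAbs t := by
  rw [isSignedCrossing_iff_units_mul hz, units_mul_signedTimes_fst, units_mul_signedTimes_snd,
    ← Nat.cast_min, ← image_signedTimes_crossingsUpTo, (signedTimes_injective _).encard_image,
    isCrossing_signedTimes_iff]
  simp only [Nat.cast_nonneg, true_and]
  rfl

theorem isSignedCrossing_iff (hz : z ≠ 0) :
    IsSignedCrossing R x₁ x₂ z k ↔ ∃ t, signedTimes (signUnit z) t = k ∧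
      IsNthCrossing (halfPath R (signUnit z)) x₁ x₂ z.natAbs t := by
  constructor
  · intro hk
    obtain ⟨-, h₁, h₂, -⟩ := (isSignedCrossing_iff_units_mul hz).1 hk
    obtain ⟨t, rfl⟩ := exists_signedTimes_eq h₁ h₂
    exact ⟨t, rfl, (isSignedCrossing_signedTimes_iff hz).1 hk⟩
  · rintro ⟨t, rfl, ht⟩
    exact (isSignedCrossing_signedTimes_iff hz).2 ht

theorem IsSignedCrossing.unique (hz : z ≠ 0) {k' : ℤ × ℤ} (hk : IsSignedCrossing R x₁ x₂ z k)
    (hk' : IsSignedCrossing R x₁ x₂ z k') : k = k' := by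
  obtain ⟨t, rfl, ht⟩ := (isSignedCrossing_iff hz).1 hk
  obtain ⟨t', rfl, ht'⟩ := (isSignedCrossing_iff hz).1 hk'
  rw [ht.unique ht']

theorem IsSignedCrossing.index_unique {z' : ℤ} (hk : IsSignedCrossing R x₁ x₂ z k)
    (hk' : IsSignedCrossing R x₁ x₂ z' k) : z = z' := by
  have hlt := hk.1.min_lt_max
  rcases hk.2 with ⟨hz, h₁, h₂, hcard⟩ | ⟨hz, h₁, h₂, hcard⟩ <;>
    rcases hk'.2 with ⟨hz', h₁', h₂', hcard'⟩ | ⟨hz', h₁', h₂', hcard'⟩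
  all_goals try omega
  all_goals
    have hnatAbs : z.natAbs = z'.natAbs := by exact_mod_cast hcard.symm.trans hcard'
    omega

theorem IsIndexedCrossing.unique {S : ℕ → ℤ} {n i : ℕ} (hz : z ≠ 0) {s : ℕ × ℕ}
    (hs : IsIndexedCrossing R S n i z s) (ht : IsIndexedCrossing R S n i z t) : s = t := by
  obtain ⟨k, hk, hs⟩ := hs
  obtain ⟨k', hk', ht⟩ := ht
  obtain rfl := hk.unique hz hk'
  exact hs.unique ht

end SignedTimes

/-! ### Crossings by the composition of two paths -/

theorem IsCrossing.apply_mem_uIcc {ι : Type*} [LinearOrder ι] {T : ι → ℤ} {x₁ x₂ : ℤ} {t : ι × ι}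
    (ht : IsCrossing T x₁ x₂ t) {u : ι} (hu : u ∈ Set.uIcc t.1 t.2) : T u ∈ Set.uIcc x₁ x₂ := by
  obtain ⟨-, h₁, h₂, hinside⟩ := ht
  by_cases hu₁ : u = t.1
  · rw [hu₁, h₁]
    exact Set.left_mem_uIcc
  by_cases hu₂ : u = t.2
  · rw [hu₂, h₂]
    exact Set.right_mem_uIcc
  · have hlo : min t.1 t.2 < u := lt_of_le_of_ne hu.1 (by grind)
    have hhi : u < max t.1 t.2 := lt_of_le_of_ne hu.2 (by grind)
    exact ⟨(hinside u hlo hhi).1.le, (hinside u hlo hhi).2.le⟩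

theorem IsCrossing.comp {ι : Type*} [LinearOrder ι] {R : ℤ → ℤ} {S : ι → ℤ} {x₁ x₂ : ℤ}
    {k : ℤ × ℤ} {t : ι × ι} (hk : IsCrossing R x₁ x₂ k) (ht : IsCrossing S k.1 k.2 t) :
    IsCrossing (fun u => R (S u)) x₁ x₂ t :=
  ⟨hk.1, (congrArg R ht.2.1).trans hk.2.1, (congrArg R ht.2.2.1).trans hk.2.2.1, fun u hlo hhi =>
    hk.2.2.2 _ (ht.2.2.2 u hlo hhi).1 (ht.2.2.2 u hlo hhi).2⟩

theorem units_mul_mem_uIcc_iff (ε : ℤˣ) {a b c : ℤ} :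
    ε * c ∈ Set.uIcc (ε * a : ℤ) (ε * b) ↔ c ∈ Set.uIcc a b := by
  rcases Int.units_eq_one_or ε with rfl | rfl <;>
    simp only [Set.mem_uIcc, Units.val_one, Units.val_neg] <;> omega

theorem natCast_mem_uIcc_iff {a b c : ℕ} : (c : ℤ) ∈ Set.uIcc (a : ℤ) b ↔ c ∈ Set.uIcc a b := by
  simp only [Set.mem_uIcc, Nat.cast_le]

theorem units_mul_natCast_mem_uIcc_iff (ε : ℤˣ) {a b c : ℕ} :
    ε * (c : ℤ) ∈ Set.uIcc (ε * a : ℤ) (ε * b) ↔ c ∈ Set.uIcc a b :=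
  (units_mul_mem_uIcc_iff ε).trans natCast_mem_uIcc_iff

theorem exists_units_mul_natCast_eq {ε : ℤˣ} {a b : ℕ} {v : ℤ}
    (hv : v ∈ Set.uIcc (ε * a : ℤ) (ε * b)) : ∃ c ∈ Set.uIcc a b, v = ε * (c : ℤ) := by
  obtain ⟨c, hc⟩ : ∃ c : ℕ, v = ε * (c : ℤ) := by
    rcases Int.units_eq_one_or ε with rfl | rfl <;>
      simp only [Set.mem_uIcc, Units.val_one, Units.val_neg] at hv ⊢
    exacts [⟨v.toNat, by omega⟩, ⟨(-v).toNat, by omega⟩]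
  exact ⟨c, (units_mul_natCast_mem_uIcc_iff ε).1 (hc ▸ hv), hc⟩

/-- When the walk `S` first completes the crossing `j` of `R`, the path `R ∘ S` first completes a
crossing, since the points of `k` before the end of `j` do not have the value `y₂`. -/
theorem IsFirstCrossingDuring.comp {R : ℤ → ℤ} {S : ℕ → ℤ} {ε : ℤˣ} {k j t s : ℕ × ℕ} {y₁ y₂ : ℤ}
    (hR : IsNearestNeighbor (halfPath R ε)) (hS : IsNearestNeighbor S)
    (hy₁ : y₁ ∈ Set.uIcc (halfPath R ε k.1) y₂)
    (hj : IsFirstCrossingDuring (halfPath R ε) y₁ y₂ k j)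
    (ht : IsCrossing S (ε * k.1) (ε * k.2) t)
    (hs : IsFirstCrossingDuring S (ε * j.1) (ε * j.2) t s) :
    IsFirstCrossingDuring (fun u => R (S u)) y₁ y₂ t s := by
  have hj₁ : (ε * j.1 : ℤ) ∈ Set.uIcc (S t.1) (ε * j.2) := by
    rw [ht.2.1, units_mul_natCast_mem_uIcc_iff]
    exact hj.fst_mem_uIcc hR hy₁
  have hcrossing : IsCrossing R y₁ y₂ (signedTimes ε j) := isCrossing_signedTimes_iff.2 hj.1
  refine (hcrossing.comp hs.1).isFirstCrossingDuring (hs.fst_mem_uIcc hS hj₁) hs.2.2.1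
    fun u hu hux => ?_
  obtain ⟨v, hv, huv⟩ := exists_units_mul_natCast_eq (ht.apply_mem_uIcc hu)
  have hjv : j.2 ∈ Set.uIcc k.1 v := (hj.mem_uIcc_of_apply_eq hR hy₁ hv
    ((congrArg R huv).symm.trans hux)).2
  obtain ⟨c, hc, hcj⟩ : ∃ c ∈ Set.uIcc t.1 u, S c = ε * j.2 := by
    refine hS.exists_eq ?_
    rwa [ht.2.1, huv, units_mul_natCast_mem_uIcc_iff]
  have hct : c ∈ Set.uIcc t.1 t.2 := Set.uIcc_subset_uIcc Set.left_mem_uIcc hu hc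
  exact Set.uIcc_subset_uIcc Set.left_mem_uIcc hc (hs.mem_uIcc_of_apply_eq hS hj₁ hct hcj).2

/-! ### The number of occurring events -/

theorem map_mem_eq_add_smul_dirac {Ω : Type*} [MeasurableSpace Ω] {P : Measure Ω} {E : Set Ω}
    (hE : MeasurableSet E) :
    P.map (fun ω => ω ∈ E) = P E • Measure.dirac True + P Eᶜ • Measure.dirac False := by
  refine Measure.ext_of_singleton fun q => ?_
  rw [Measure.map_apply (measurable_mem.2 hE) (measurableSet_singleton q)]
  by_cases hq : q
  · simp [hq, Set.preimage]
  · simp [hq, Set.preimage, Set.compl_def]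

theorem isSetBernoulli_of_iIndepSet {Ω ι : Type*} [MeasurableSpace Ω] {P : Measure Ω}
    [Countable ι] {E : ι → Set Ω} (hE : ∀ m, MeasurableSet (E m)) (hindep : iIndepSet E P)
    {u : Set ι} {p : unitInterval} (hu : ∀ m ∈ u, P (E m) = unitInterval.toNNReal p)
    (hu' : ∀ m ∉ u, P (E m) = 0) :
    IsSetBernoulli (fun ω => {m | ω ∈ E m}) u p P := by
  have : IsProbabilityMeasure P := hindep.isProbabilityMeasure
  have hmem : ∀ m, Measurable fun ω => ω ∈ E m := fun m => measurable_mem.2 (hE m)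
  have hset : Measurable fun Q : ι → Prop => {m | Q m} := MeasurableEquiv.setOfPred.measurable
  have hlaw := (show iIndepFun (fun m ω => ω ∈ E m) P from
    iIndep_comap_mem_iff.2 hindep).map_fun_eq_infinitePi_map hmem
  have hfactor : ∀ m, P.map (fun ω => ω ∈ E m) = unitInterval.toNNReal p • Measure.dirac (m ∈ u) +
      unitInterval.toNNReal (unitInterval.symm p) • Measure.dirac False := fun m => by
    rw [map_mem_eq_add_smul_dirac (hE m), prob_compl_eq_one_sub (hE m)]
    by_cases hm : m ∈ u
    · have hsymm : (1 : ENNReal) - unitInterval.toNNReal p =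
          unitInterval.toNNReal (unitInterval.symm p) := by
        rw [← ENNReal.coe_one, ← unitInterval.toNNReal_symm_add_toNNReal p, ENNReal.coe_add,
          ENNReal.add_sub_cancel_right ENNReal.coe_ne_top]
      simp only [hu m hm, hm, hsymm]
      rfl
    · simp [hu' m hm, hm, ← add_smul]
  refine ⟨(measurable_set_iff.2 hmem).aemeasurable, ?_⟩
  rw [setBernoulli_eq_map, ← funext hfactor, ← hlaw,
    Measure.map_map hset (measurable_pi_iff.2 hmem)]
  rfl

theorem hasLaw_ncard_binomial_of_measure_biInter {Ω : Type*} [MeasurableSpace Ω] {P : Measure Ω}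
    [IsProbabilityMeasure P] {E : ℕ → Set Ω} (hE : ∀ m, MeasurableSet (E m)) {n : ℕ}
    {p : unitInterval}
    (h : ∀ M ⊆ Finset.range n, P (⋂ m ∈ M, E m) = (unitInterval.toNNReal p : ENNReal) ^ M.card) :
    HasLaw (fun ω => {m | m < n ∧ ω ∈ E m}.ncard) (binomial n p) P := by
  have hE' : ∀ m, MeasurableSet {ω | m < n ∧ ω ∈ E m} := fun m =>
    (MeasurableSet.const _).inter (hE m)
  have hP : ∀ m < n, P {ω | m < n ∧ ω ∈ E m} = unitInterval.toNNReal p := fun m hm => by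
    simpa [hm] using h {m} (by simpa using hm)
  have hP' : ∀ m, ¬ m < n → P {ω | m < n ∧ ω ∈ E m} = 0 := fun m hm => by simp [hm]
  have hindep : iIndepSet (fun m => {ω | m < n ∧ ω ∈ E m}) P := by
    rw [iIndepSet_iff_meas_biInter hE']
    intro M
    by_cases hM : M ⊆ Finset.range n
    · rw [Finset.prod_congr rfl fun m hm => hP m (Finset.mem_range.1 (hM hm)), Finset.prod_const,
        ← h M hM]
      refine congrArg P (Set.iInter₂_congr fun m hm => ?_)
      simp [Finset.mem_range.1 (hM hm)]
    · obtain ⟨m, hm, hmn⟩ := Finset.not_subset.1 hM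
      rw [Finset.prod_eq_zero hm (hP' m (by simpa using hmn))]
      exact measure_mono_null (Set.biInter_subset_of_mem hm) (hP' m (by simpa using hmn))
  exact HasLaw.comp (Y := Set.ncard) (ν := binomial n p) ⟨measurable_ncard.aemeasurable, rfl⟩
    (isSetBernoulli_of_iIndepSet hE' hindep (u := Set.Iio n) hP hP')

/-! ### The loci of the scenery and of the walk -/

theorem IsLocus.isStraightLocus_iff {T : ℕ → ℤ} {l : LocusLabel} {s : ℕ × ℕ} (hs : IsLocus T l s) :
    IsStraightLocus T l ↔ |(s.1 : ℤ) - s.2| = |l.j₁ - l.j₂| := by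
  refine ⟨?_, fun h => ⟨s, hs, h⟩⟩
  rintro ⟨r, hr, h⟩
  rwa [hs.unique hr]

theorem IsFirstCrossingDuring.straightBit_eq_one_iff {T : ℕ → ℤ} {t s : ℕ × ℕ} {m : ℕ}
    (hs : IsFirstCrossingDuring T (3 * m) (3 * m + 3) t s) :
    straightBit T t m = 1 ↔ |(s.1 : ℤ) - s.2| = 3 := by
  have hlen : |(3 * m : ℤ) - (3 * m + 3)| = 3 := by simp
  classical
  rw [straightBit, hlen, ite_eq_left_iff]
  refine ⟨fun h => ?_, fun h hnot => absurd ⟨s, hs, h⟩ hnot⟩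
  obtain ⟨r, hr, h3⟩ := not_not.1 fun hnot => zero_ne_one (h hnot)
  rwa [hs.unique hr]

theorem abs_units_mul_sub (ε : ℤˣ) (a b : ℤ) : |ε * a - ε * b| = |a - b| := by
  rw [← mul_sub, abs_mul, Int.isUnit_iff_abs_eq.1 ε.isUnit, one_mul]

/-- The label of the first crossing of `(3m, 3m + 3)` during the `|z|`-th crossing of `(0, 3n)`, to
be used for the half `signUnit z` of the scenery walk. -/
def sceneryLocus (n : ℕ) (z : ℤ) (m : ℕ) : LocusLabel := ⟨0, 3 * n, z.natAbs, 3 * m, 3 * m + 3⟩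

/-- For `a = (i, z)`, the label of the first crossing of `j z m` during the `i`-th crossing of
`k z`, where `k z` and `j z m` are times of the half `signUnit z` of the scenery walk. -/
def walkLocus (k : ℤ → ℕ × ℕ) (j : ℤ → ℕ → ℕ × ℕ) (a : ℕ × ℤ) (m : ℕ) : LocusLabel :=
  ⟨signUnit a.2 * (k a.2).1, signUnit a.2 * (k a.2).2, a.1,
    signUnit a.2 * (j a.2 m).1, signUnit a.2 * (j a.2 m).2⟩

theorem sceneryLocus_isAdmissible {n : ℕ} {z : ℤ} {m : ℕ} (hz : z ≠ 0) (hm : m < n) :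
    (sceneryLocus n z m).IsAdmissible where
  pos := Int.natAbs_pos.2 hz
  ne := by dsimp only [sceneryLocus]; omega
  length := by simp [sceneryLocus]
  left_mem := by simp only [sceneryLocus, Set.mem_uIcc]; omega
  right_mem := by simp only [sceneryLocus, Set.mem_uIcc]; omega

theorem disjoint_inner_endpoints_sceneryLocus (n : ℕ) (z z' : ℤ) (m m' : ℕ) :
    Disjoint (sceneryLocus n z m).inner (sceneryLocus n z' m').endpoints := by
  rw [Set.disjoint_left]
  rintro x ⟨hlo, hhi⟩ (rfl | rfl | rfl | rfl) <;> dsimp only [sceneryLocus] at hlo hhi <;> omega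

theorem sceneryLocus_separated (n : ℕ) {z z' : ℤ} {m m' : ℕ} (h : m = m' → z.natAbs ≠ z'.natAbs) :
    (sceneryLocus n z m).Separated (sceneryLocus n z' m') := by
  by_cases hm : m = m'
  · subst hm
    exact .inr ⟨z'.natAbs, (h rfl).symm, rfl⟩
  · refine .inl (Set.disjoint_left.2 ?_)
    rintro x ⟨hlo, hhi⟩ ⟨hlo', hhi'⟩
    dsimp only [sceneryLocus] at hlo hhi hlo' hhi'
    omega

/-- For `z ≠ 0`, `k z` is the `z`-th crossing by `R` of `(0, 3n)` up to the sign of the times, and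
`j z m` is the first crossing of `(3m, 3m + 3)` during `k z`. -/
structure IsCrossingFamily (R : ℤ → ℤ) (n : ℕ) (k : ℤ → ℕ × ℕ) (j : ℤ → ℕ → ℕ × ℕ) : Prop where
  nth : ∀ z ≠ 0, IsNthCrossing (halfPath R (signUnit z)) 0 (3 * n) z.natAbs (k z)
  first : ∀ z ≠ 0, ∀ m < n,
    IsFirstCrossingDuring (halfPath R (signUnit z)) (3 * m) (3 * m + 3) (k z) (j z m)

theorem exists_isCrossingFamily {R : ℤ → ℤ} {n : ℕ} (hn : 0 < n)
    (hR : ∀ ε, IsNearestNeighbor (halfPath R ε)) (hrec : ∀ ε, IsRecurrent (halfPath R ε)) :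
    ∃ k j, IsCrossingFamily R n k j := by
  have hk : ∀ z : ℤ, ∃ k, z ≠ 0 →
      IsNthCrossing (halfPath R (signUnit z)) 0 (3 * n) z.natAbs k := fun z => by
    obtain ⟨k, hk⟩ := (hR (signUnit z)).exists_isNthCrossing (hrec _) (x₁ := 0) (x₂ := 3 * n)
      (by omega) (z.natAbs - 1)
    exact ⟨k, fun hz => by rwa [Nat.sub_add_cancel (Int.natAbs_pos.2 hz)] at hk⟩
  choose k hk using hk
  have hj : ∀ (z : ℤ) (m : ℕ), ∃ j, z ≠ 0 → m < n →
      IsFirstCrossingDuring (halfPath R (signUnit z)) (3 * m) (3 * m + 3) (k z) j := fun z m => by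
    by_cases h : z ≠ 0 ∧ m < n
    · obtain ⟨-, h₁, h₂, -⟩ := (hk z h.1).1
      obtain ⟨j, hj⟩ := (hR (signUnit z)).exists_isFirstCrossingDuring (x₁ := 3 * m)
        (x₂ := 3 * m + 3) (t := k z) (by omega) (by rw [h₁, h₂, Set.mem_uIcc]; omega)
        (by rw [h₁, h₂, Set.mem_uIcc]; omega)
      exact ⟨j, fun _ _ => hj⟩
    · exact ⟨0, fun hz hm => absurd ⟨hz, hm⟩ h⟩
  choose j hj using hj
  exact ⟨k, j, hk, fun z hz m => hj z m hz⟩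

namespace IsCrossingFamily

variable {R : ℤ → ℤ} {n : ℕ} {k : ℤ → ℕ × ℕ} {j : ℤ → ℕ → ℕ × ℕ} {z : ℤ} {m : ℕ} {a b : ℕ × ℤ}

theorem isSignedCrossing (h : IsCrossingFamily R n k j) (hz : z ≠ 0) :
    IsSignedCrossing R 0 (3 * n) z (signedTimes (signUnit z) (k z)) :=
  (isSignedCrossing_signedTimes_iff hz).2 (h.nth z hz)

theorem isIndexedCrossing_iff (h : IsCrossingFamily R n k j) (hz : z ≠ 0) {S : ℕ → ℤ} {i : ℕ}
    {t : ℕ × ℕ} : IsIndexedCrossing R S n i z t ↔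
      IsNthCrossing S (signUnit z * (k z).1) (signUnit z * (k z).2) i t := by
  refine ⟨?_, fun ht => ⟨_, h.isSignedCrossing hz, ht⟩⟩
  rintro ⟨k', hk', ht⟩
  obtain rfl := hk'.unique hz (h.isSignedCrossing hz)
  exact ht

theorem isCrossing_first (h : IsCrossingFamily R n k j) (hz : z ≠ 0) (hm : m < n) :
    IsCrossing R (3 * m) (3 * m + 3) (signedTimes (signUnit z) (j z m)) :=
  isCrossing_signedTimes_iff.2 (h.first z hz m hm).1

theorem isStraightLocus_sceneryLocus_iff (h : IsCrossingFamily R n k j) (hz : z ≠ 0) (hm : m < n) :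
    IsStraightLocus (halfPath R (signUnit z)) (sceneryLocus n z m) ↔
      |((j z m).1 : ℤ) - (j z m).2| = 3 := by
  have hs : IsLocus (halfPath R (signUnit z)) (sceneryLocus n z m) (j z m) :=
    ⟨k z, h.nth z hz, h.first z hz m hm⟩
  rw [hs.isStraightLocus_iff, (sceneryLocus_isAdmissible hz hm).length]

theorem walkLocus_mem_uIcc (h : IsCrossingFamily R n k j) (ha : a.2 ≠ 0) (hm : m < n) :
    (walkLocus k j a m).j₁ ∈ Set.uIcc (walkLocus k j a m).k₁ (walkLocus k j a m).k₂ ∧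
      (walkLocus k j a m).j₂ ∈ Set.uIcc (walkLocus k j a m).k₁ (walkLocus k j a m).k₂ :=
  ⟨(units_mul_natCast_mem_uIcc_iff _).2 (h.first a.2 ha m hm).2.1,
    (units_mul_natCast_mem_uIcc_iff _).2 (h.first a.2 ha m hm).2.2.1⟩

theorem walkLocus_isAdmissible (h : IsCrossingFamily R n k j) (hi : 0 < a.1) (ha : a.2 ≠ 0)
    (hm : m < n)
    (hstraight : IsStraightLocus (halfPath R (signUnit a.2)) (sceneryLocus n a.2 m)) :
    (walkLocus k j a m).IsAdmissible where
  pos := hi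
  ne := (h.isSignedCrossing ha).1.fst_ne_snd
  length := (abs_units_mul_sub _ _ _).trans ((h.isStraightLocus_sceneryLocus_iff ha hm).1 hstraight)
  left_mem := (h.walkLocus_mem_uIcc ha hm).1
  right_mem := (h.walkLocus_mem_uIcc ha hm).2

theorem apply_mem_Ioo (h : IsCrossingFamily R n k j) (ha : a.2 ≠ 0) (hm : m < n) {x : ℤ}
    (hx : x ∈ (walkLocus k j a m).inner) : R x ∈ Set.Ioo (3 * m : ℤ) (3 * m + 3) := by
  simpa using (h.isCrossing_first ha hm).2.2.2 x hx.1 hx.2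

theorem three_dvd_apply (h : IsCrossingFamily R n k j) (ha : a.2 ≠ 0) (hm : m < n) {x : ℤ}
    (hx : x ∈ (walkLocus k j a m).endpoints) : 3 ∣ R x := by
  obtain ⟨-, hk₁, hk₂, -⟩ := (h.isSignedCrossing ha).1
  obtain ⟨-, hj₁, hj₂, -⟩ := h.isCrossing_first ha hm
  rcases hx with rfl | rfl | rfl | rfl
  exacts [hk₁ ▸ dvd_zero _, hk₂ ▸ dvd_mul_right _ _, hj₁ ▸ dvd_mul_right _ _,
    hj₂ ▸ dvd_add_self_right.2 (dvd_mul_right _ _)]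

theorem disjoint_inner_endpoints_walkLocus (h : IsCrossingFamily R n k j) (ha : a.2 ≠ 0)
    (hb : b.2 ≠ 0) (hm : m < n) {m' : ℕ} (hm' : m' < n) :
    Disjoint (walkLocus k j a m).inner (walkLocus k j b m').endpoints := by
  refine Set.disjoint_left.2 fun x hx hx' => ?_
  obtain ⟨hlo, hhi⟩ := h.apply_mem_Ioo ha hm hx
  obtain ⟨c, hc⟩ := h.three_dvd_apply hb hm' hx'
  omega

theorem disjoint_inner_walkLocus_of_snd_ne (h : IsCrossingFamily R n k j) (ha : a.2 ≠ 0)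
    (hb : b.2 ≠ 0) (hab : a.2 ≠ b.2) (hm : m < n) :
    Disjoint (walkLocus k j a m).inner (walkLocus k j b m).inner := by
  refine Set.disjoint_left.2 ?_
  rintro x ⟨hlo, hhi⟩ ⟨hlo', hhi'⟩
  obtain ⟨ha₁, ha₂⟩ := h.walkLocus_mem_uIcc ha hm
  obtain ⟨hb₁, hb₂⟩ := h.walkLocus_mem_uIcc hb hm
  have hka := h.isSignedCrossing ha
  have hkb := h.isSignedCrossing hb
  rw [Set.mem_uIcc] at ha₁ ha₂ hb₁ hb₂
  have heq := hka.1.eq_of_overlap hkb.1 (by dsimp only [walkLocus, signedTimes] at *; omega)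
    (by dsimp only [walkLocus, signedTimes] at *; omega)
  rw [heq] at hka
  exact hab (hka.index_unique hkb)

theorem walkLocus_separated (h : IsCrossingFamily R n k j) (ha : a.2 ≠ 0) (hb : b.2 ≠ 0)
    (hm : m < n) {m' : ℕ} (hm' : m' < n) (hne : m = m' → a ≠ b) :
    (walkLocus k j a m).Separated (walkLocus k j b m') := by
  by_cases hmm : m = m'
  · subst hmm
    by_cases hz : a.2 = b.2
    · refine .inr ⟨b.1, fun hi => hne rfl (Prod.ext hi.symm hz), ?_⟩
      simp only [walkLocus, hz]
    · exact .inl (h.disjoint_inner_walkLocus_of_snd_ne ha hb hz hm)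
  · refine .inl (Set.disjoint_left.2 fun x hx hx' => ?_)
    obtain ⟨hlo, hhi⟩ := h.apply_mem_Ioo ha hm hx
    obtain ⟨hlo', hhi'⟩ := h.apply_mem_Ioo hb hm' hx'
    omega

/-- The first crossing by `R ∘ S` is the first crossing by `S` of the first crossing by `R`. Since
neither takes less than `3` steps, it is straight if and only if both are. -/
theorem straightBit_eq_one_iff (h : IsCrossingFamily R n k j)
    (hR : IsNearestNeighbor (halfPath R (signUnit a.2))) {S : ℕ → ℤ} (hS : IsNearestNeighbor S)
    (ha : a.2 ≠ 0) {t : ℕ × ℕ} (ht : IsIndexedCrossing R S n a.1 a.2 t) (hm : m < n) :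
    straightBit (fun u => R (S u)) t m = 1 ↔
      IsStraightLocus (halfPath R (signUnit a.2)) (sceneryLocus n a.2 m) ∧
        IsStraightLocus S (walkLocus k j a m) := by
  rw [h.isIndexedCrossing_iff ha] at ht
  have hj := h.first a.2 ha m hm
  obtain ⟨hj₁, hj₂⟩ := h.walkLocus_mem_uIcc ha hm
  obtain ⟨s, hs⟩ := hS.exists_isFirstCrossingDuring (t := t) (h.isCrossing_first ha hm).fst_ne_snd
    (by rwa [ht.1.2.1, ht.1.2.2.1]) (by rwa [ht.1.2.1, ht.1.2.2.1])
  have hRS : IsFirstCrossingDuring (fun u => R (S u)) (3 * m) (3 * m + 3) t s :=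
    IsFirstCrossingDuring.comp hR hS (by rw [(h.nth a.2 ha).1.2.1, Set.mem_uIcc]; omega) hj ht.1 hs
  have hlocus : IsLocus S (walkLocus k j a m) s := ⟨t, ht, hs⟩
  have hlenS := hs.1.abs_sub_le hS
  have hlenR := hj.1.abs_sub_le hR
  rw [signedTimes, abs_units_mul_sub] at hlenS
  rw [hRS.straightBit_eq_one_iff, h.isStraightLocus_sceneryLocus_iff ha hm,
    hlocus.isStraightLocus_iff, walkLocus, abs_units_mul_sub]
  have hthree : |(3 * m : ℤ) - (3 * m + 3)| = 3 := by simp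
  omega

end IsCrossingFamily

/-! ### The probability of common straight crossings -/

/-- The pairs `(r, σ)` of a scenery walk and a random walk for which, for all `(i, z) ∈ A`, the
`i`-th crossing by `σ` of the `z`-th crossing by `r` of `(0, 3n)` exists and has the bit
`w(m) = 1`. -/
def allStraight (n : ℕ) (A : Finset (ℕ × ℤ)) (m : ℕ) : Set ((ℤ → ℤ) × (ℕ → ℤ)) :=
  {x | ∀ a ∈ A, ∃ t, IsIndexedCrossing x.1 x.2 n a.1 a.2 t ∧
    straightBit (fun u => x.1 (x.2 u)) t m = 1}

/-- The scenery walks whose loci with labels `(z, m)` in `Z × M` are straight. -/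
def straightScenery (n : ℕ) (Z : Finset ℤ) (M : Finset ℕ) : Set (ℤ → ℤ) :=
  {r | ∀ z ∈ Z, ∀ m ∈ M, IsStraightLocus (halfPath r (signUnit z)) (sceneryLocus n z m)}

theorem measurableSet_straightScenery (n : ℕ) (Z : Finset ℤ) (M : Finset ℕ) :
    MeasurableSet (straightScenery n Z M) := by
  simp only [straightScenery, Set.ofPred_forall]
  exact Finset.measurableSet_biInter _ fun z _ => Finset.measurableSet_biInter _ fun m _ =>
    measurable_halfPath _ (measurableSet_isStraightLocus _)

theorem straightBit_eq_one_iff_exists {T : ℕ → ℤ} {t : ℕ × ℕ} {m : ℕ} :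
    straightBit T t m = 1 ↔ ∃ s, IsFirstCrossingDuring T (3 * m) (3 * m + 3) t s ∧
      |(s.1 : ℤ) - s.2| = |(3 * m : ℤ) - (3 * m + 3)| := by
  classical
  simp [straightBit]

theorem measurableSet_straightBit_eq_one (t : ℕ × ℕ) (m : ℕ) :
    MeasurableSet {T | straightBit T t m = 1} := by
  simp only [straightBit_eq_one_iff_exists, Set.ofPred_exists]
  exact MeasurableSet.iUnion fun s =>
    (measurableSet_isFirstCrossingDuring _ _ t s).inter (MeasurableSet.const _)

theorem measurableSet_isSignedCrossing (x₁ x₂ : ℤ) {z : ℤ} (hz : z ≠ 0) (k : ℤ × ℤ) :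
    MeasurableSet {R | IsSignedCrossing R x₁ x₂ z k} := by
  simp only [isSignedCrossing_iff hz, Set.ofPred_exists]
  exact MeasurableSet.iUnion fun t => (MeasurableSet.const _).inter
    (measurable_halfPath _ (measurableSet_isNthCrossing x₁ x₂ _ t))

theorem measurableSet_isIndexedCrossing (n i : ℕ) {z : ℤ} (hz : z ≠ 0) (t : ℕ × ℕ) :
    MeasurableSet {x : (ℤ → ℤ) × (ℕ → ℤ) | IsIndexedCrossing x.1 x.2 n i z t} := by
  simp only [IsIndexedCrossing, Set.ofPred_exists]
  exact MeasurableSet.iUnion fun k =>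
    (measurable_fst (measurableSet_isSignedCrossing _ _ hz k)).inter
      (measurable_snd (measurableSet_isNthCrossing _ _ i t))

theorem measurable_comp_pair :
    Measurable fun (x : (ℤ → ℤ) × (ℕ → ℤ)) u => x.1 (x.2 u) := by
  have heval : Measurable fun y : (ℤ → ℤ) × ℤ => y.1 y.2 :=
    measurable_from_prod_countable_left fun v => measurable_pi_apply v
  exact measurable_pi_iff.2 fun u =>
    heval.comp (measurable_fst.prodMk ((measurable_pi_apply u).comp measurable_snd))

theorem measurableSet_allStraight (n : ℕ) {A : Finset (ℕ × ℤ)} (hA : ∀ a ∈ A, a.2 ≠ 0) (m : ℕ) :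
    MeasurableSet (allStraight n A m) := by
  simp only [allStraight, Set.ofPred_forall, Set.ofPred_exists]
  exact Finset.measurableSet_biInter _ fun a ha => MeasurableSet.iUnion fun t =>
    (measurableSet_isIndexedCrossing n a.1 (hA a ha) t).inter
      (measurable_comp_pair (measurableSet_straightBit_eq_one t m))

theorem IsCrossingFamily.exists_isIndexedCrossing {r : ℤ → ℤ} {n : ℕ} {k : ℤ → ℕ × ℕ}
    {j : ℤ → ℕ → ℕ × ℕ} (h : IsCrossingFamily r n k j) {σ : ℕ → ℤ} (hσ : IsNearestNeighbor σ)
    (hrec : IsRecurrent σ) {i : ℕ} (hi : 0 < i) {z : ℤ} (hz : z ≠ 0) :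
    ∃ t, IsIndexedCrossing r σ n i z t := by
  obtain ⟨t, ht⟩ := hσ.exists_isNthCrossing hrec (h.isSignedCrossing hz).1.fst_ne_snd (i - 1)
  rw [Nat.sub_add_cancel hi] at ht
  exact ⟨t, (h.isIndexedCrossing_iff hz).2 ht⟩

theorem mem_allStraight_iff {r : ℤ → ℤ} {σ : ℕ → ℤ} {n : ℕ} {k : ℤ → ℕ × ℕ}
    {j : ℤ → ℕ → ℕ × ℕ} (h : IsCrossingFamily r n k j)
    (hr : ∀ ε, IsNearestNeighbor (halfPath r ε)) (hσ : IsNearestNeighbor σ)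
    (hrec : IsRecurrent σ) {A : Finset (ℕ × ℤ)} (hA : ∀ a ∈ A, 0 < a.1 ∧ a.2 ≠ 0) {m : ℕ}
    (hm : m < n) :
    (r, σ) ∈ allStraight n A m ↔
      ∀ a ∈ A, IsStraightLocus (halfPath r (signUnit a.2)) (sceneryLocus n a.2 m) ∧
        IsStraightLocus σ (walkLocus k j a m) := by
  refine forall₂_congr fun a ha => ?_
  obtain ⟨hi, hz⟩ := hA a ha
  constructor
  · rintro ⟨t, ht, hbit⟩
    exact (h.straightBit_eq_one_iff (hr _) hσ hz ht hm).1 hbit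
  · intro hstraight
    obtain ⟨t, ht⟩ := h.exists_isIndexedCrossing hσ hrec hi hz
    exact ⟨t, ht, (h.straightBit_eq_one_iff (hr _) hσ hz ht hm).2 hstraight⟩

section Probability

variable {Ω : Type*} [MeasurableSpace Ω] {P : Measure Ω} [IsProbabilityMeasure P] {n : ℕ}
  {M : Finset ℕ}

theorem measure_pair_mem_eq_mul {α β : Type*} [MeasurableSpace α] [MeasurableSpace β] {X : Ω → α}
    {Y : Ω → β} (hX : Measurable X) (hY : Measurable Y) (hindep : IndepFun X Y P)
    {B : Set (α × β)} (hB : MeasurableSet B) {C : Set α} (hC : MeasurableSet C) {c : ENNReal}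
    (h : ∀ᵐ ω ∂P, P {ω' | (X ω, Y ω') ∈ B} = C.indicator (fun _ => c) (X ω)) :
    P {ω | (X ω, Y ω) ∈ B} = c * P {ω | X ω ∈ C} := by
  have hlaw := (indepFun_iff_map_prod_eq_prod_map_map hX.aemeasurable hY.aemeasurable).1 hindep
  calc P {ω | (X ω, Y ω) ∈ B}
      = ((P.map X).prod (P.map Y)) B := by
        rw [← hlaw, Measure.map_apply (hX.prodMk hY) hB]
        rfl
    _ = ∫⁻ ω, P {ω' | (X ω, Y ω') ∈ B} ∂P := by
        rw [Measure.prod_apply hB, lintegral_map (measurable_measure_prodMk_left hB) hX]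
        refine lintegral_congr fun ω => ?_
        rw [Measure.map_apply hY (measurable_prodMk_left hB)]
        rfl
    _ = ∫⁻ ω, (X ⁻¹' C).indicator (fun _ => c) ω ∂P := lintegral_congr_ae h
    _ = c * P {ω | X ω ∈ C} := lintegral_indicator_const (hX hC) c

theorem IsSimpleRandomWalk.measure_forall_isStraightLocus_sceneryLocus {S : ℕ → Ω → ℤ}
    (hS : IsSimpleRandomWalk P S) {Z : Finset ℤ} (hZ : ∀ z ∈ Z, z ≠ 0)
    (hinj : Set.InjOn Int.natAbs Z) (hM : ∀ m ∈ M, m < n) :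
    P {ω | ∀ z ∈ Z, ∀ m ∈ M, IsStraightLocus (fun k => S k ω) (sceneryLocus n z m)} =
      (3 / 4) ^ (Z.card * M.card) := by
  have h := hS.measure_forall_isStraightLocus (l := fun b : ℤ × ℕ => sceneryLocus n b.1 b.2)
    (s := Z ×ˢ M) ?_ (fun b _ c _ => disjoint_inner_endpoints_sceneryLocus n _ _ _ _) ?_
  · rw [Finset.card_product] at h
    refine Eq.trans (congrArg P (Set.ext fun ω => ?_)) h
    simp only [Set.mem_ofPred_eq, Finset.mem_product, Prod.forall, and_imp]
    exact forall_congr' fun z => forall_comm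
  · intro b hb
    rw [Finset.mem_product] at hb
    exact sceneryLocus_isAdmissible (hZ _ hb.1) (hM _ hb.2)
  · intro b hb c hc hbc
    rw [Finset.mem_coe, Finset.mem_product] at hb hc
    exact sceneryLocus_separated n fun hm hz => hbc (Prod.ext (hinj hb.1 hc.1 hz) hm)

theorem IsSimpleRandomWalk.measure_forall_isStraightLocus_walkLocus {S : ℕ → Ω → ℤ}
    (hS : IsSimpleRandomWalk P S) {r : ℤ → ℤ} {k : ℤ → ℕ × ℕ} {j : ℤ → ℕ → ℕ × ℕ}
    (h : IsCrossingFamily r n k j) {A : Finset (ℕ × ℤ)} (hA : ∀ a ∈ A, 0 < a.1 ∧ a.2 ≠ 0)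
    (hM : ∀ m ∈ M, m < n) (hstraight : ∀ a ∈ A, ∀ m ∈ M,
      IsStraightLocus (halfPath r (signUnit a.2)) (sceneryLocus n a.2 m)) :
    P {ω | ∀ a ∈ A, ∀ m ∈ M, IsStraightLocus (fun u => S u ω) (walkLocus k j a m)} =
      (3 / 4) ^ (A.card * M.card) := by
  have h := hS.measure_forall_isStraightLocus (l := fun b : (ℕ × ℤ) × ℕ => walkLocus k j b.1 b.2)
    (s := A ×ˢ M) ?_ ?_ ?_
  · rw [Finset.card_product] at h
    refine Eq.trans (congrArg P (Set.ext fun ω => ?_)) h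
    simp only [Set.mem_ofPred_eq, Finset.mem_product, Prod.forall, and_imp]
    exact forall₂_congr fun i z => forall_comm
  · intro b hb
    rw [Finset.mem_product] at hb
    exact h.walkLocus_isAdmissible (hA _ hb.1).1 (hA _ hb.1).2 (hM _ hb.2) (hstraight _ hb.1 _ hb.2)
  · intro b hb c hc
    rw [Finset.mem_product] at hb hc
    exact h.disjoint_inner_endpoints_walkLocus (hA _ hb.1).2 (hA _ hc.1).2 (hM _ hb.2) (hM _ hc.2)
  · intro b hb c hc hbc
    rw [Finset.mem_coe, Finset.mem_product] at hb hc
    exact h.walkLocus_separated (hA _ hb.1).2 (hA _ hc.1).2 (hM _ hb.2) (hM _ hc.2)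
      fun hm ha => hbc (Prod.ext ha hm)

variable {ξ : ℤ → Ω → Fin 2}

/-- The two halves of the scenery walk are independent, and `|z|` determines `z` on each of them. -/
theorem IsFairScenery.measure_mem_straightScenery (hξ : IsFairScenery P ξ) {Z : Finset ℤ}
    (hZ : ∀ z ∈ Z, z ≠ 0) (hM : ∀ m ∈ M, m < n) :
    P {ω | (sceneryWalk fun k => ξ k ω) ∈ straightScenery n Z M} =
      (3 / 4) ^ (Z.card * M.card) := by
  let half : ℤˣ → Finset ℤ := fun ε => {z ∈ Z | signUnit z = ε}
  let straight : ℤˣ → Set (ℕ → ℤ) := fun ε =>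
    {T | ∀ z ∈ half ε, ∀ m ∈ M, IsStraightLocus T (sceneryLocus n z m)}
  have hmeas : ∀ ε, MeasurableSet (straight ε) := fun ε => by
    simp only [straight, Set.ofPred_forall]
    exact Finset.measurableSet_biInter _ fun z _ => Finset.measurableSet_biInter _ fun m _ =>
      measurableSet_isStraightLocus _
  have hinj : ∀ ε, Set.InjOn Int.natAbs (half ε) := fun ε z hz z' hz' habs => by
    rw [← signUnit_mul_natAbs z, ← signUnit_mul_natAbs z', habs, (Finset.mem_filter.1 hz).2,
      (Finset.mem_filter.1 hz').2]
  have hhalf : ∀ ε, P ((fun ω => halfPath (sceneryWalk fun k => ξ k ω) ε) ⁻¹' straight ε) =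
      (3 / 4) ^ ((half ε).card * M.card) := fun ε =>
    (hξ.isSimpleRandomWalk_halfPath ε).measure_forall_isStraightLocus_sceneryLocus
      (fun z hz => hZ z (Finset.mem_filter.1 hz).1) (hinj ε) hM
  have hcard : (half 1).card + (half (-1)).card = Z.card := by
    simp only [half, ← Int.units_ne_iff_eq_neg]
    exact Finset.card_filter_add_card_filter_not _
  have hsplit : ∀ r, r ∈ straightScenery n Z M ↔
      halfPath r 1 ∈ straight 1 ∧ halfPath r (-1) ∈ straight (-1) := fun r => by
    simp only [straightScenery, straight, half, Set.mem_ofPred_eq, Finset.mem_filter, and_imp,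
      ← forall₂_and]
    refine forall₂_congr fun z _ => ?_
    rcases Int.units_eq_one_or (signUnit z) with hε | hε <;> simp [hε]
  have hprod := hξ.indepFun_halfPath.measure_inter_preimage_eq_mul _ _ (hmeas 1) (hmeas (-1))
  rw [hhalf, hhalf, ← pow_add, ← add_mul, hcard] at hprod
  exact (congrArg P (Set.ext fun ω => hsplit _)).trans hprod

theorem IsFairScenery.ae_isNearestNeighbor_and_isRecurrent (hξ : IsFairScenery P ξ) :
    ∀ᵐ ω ∂P, (∀ ε, IsNearestNeighbor (halfPath (sceneryWalk fun k => ξ k ω) ε)) ∧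
      ∀ ε, IsRecurrent (halfPath (sceneryWalk fun k => ξ k ω) ε) :=
  (ae_all_iff.2 fun ε => (hξ.isSimpleRandomWalk_halfPath ε).ae_isNearestNeighbor).and
    (ae_all_iff.2 fun ε => (hξ.isSimpleRandomWalk_halfPath ε).ae_isRecurrent)

/-- The loci of `S` are admissible only if the loci of `r` are straight; if these are not, then
`(r, S)` is not in `allStraight` either. -/
theorem IsCrossingFamily.measure_forall_mem_allStraight {S : ℕ → Ω → ℤ} {r : ℤ → ℤ} {k : ℤ → ℕ × ℕ}
    {j : ℤ → ℕ → ℕ × ℕ} (h : IsCrossingFamily r n k j) (hr : ∀ ε, IsNearestNeighbor (halfPath r ε))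
    (hS : IsSimpleRandomWalk P S) {A : Finset (ℕ × ℤ)} (hA : ∀ a ∈ A, 0 < a.1 ∧ a.2 ≠ 0)
    (hM : ∀ m ∈ M, m < n) :
    P {ω | ∀ m ∈ M, (r, fun k => S k ω) ∈ allStraight n A m} =
      (straightScenery n (A.image Prod.snd) M).indicator
        (fun _ => (3 / 4) ^ (A.card * M.card)) r := by
  have hiff : ∀ᵐ ω ∂P, (∀ m ∈ M, (r, fun k => S k ω) ∈ allStraight n A m) ↔
      r ∈ straightScenery n (A.image Prod.snd) M ∧
        ∀ a ∈ A, ∀ m ∈ M, IsStraightLocus (fun u => S u ω) (walkLocus k j a m) := by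
    filter_upwards [hS.ae_isNearestNeighbor, hS.ae_isRecurrent] with ω hσ hrec
    have hmem : ∀ m ∈ M, (r, fun k => S k ω) ∈ allStraight n A m ↔ _ := fun m hm =>
      mem_allStraight_iff h hr hσ hrec hA (hM m hm)
    simp only [straightScenery, Set.mem_ofPred_eq, Finset.forall_mem_image]
    grind
  by_cases hstraight : r ∈ straightScenery n (A.image Prod.snd) M
  · rw [Set.indicator_of_mem hstraight, ← hS.measure_forall_isStraightLocus_walkLocus h hA hM
      (Finset.forall_mem_image.1 hstraight)]
    exact measure_congr (Filter.eventuallyEq_set.2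
      (hiff.mono fun ω hω => hω.trans (and_iff_right hstraight)))
  · rw [Set.indicator_of_notMem hstraight, measure_eq_zero_iff_ae_notMem]
    exact hiff.mono fun ω hω hmem => hstraight (hω.1 hmem).1

theorem measure_forall_mem_allStraight {S : ℕ → Ω → ℤ} (hξ : IsFairScenery P ξ)
    (hS : IsSimpleRandomWalk P S) (hindep : IndepFun (fun ω k => ξ k ω) (fun ω k => S k ω) P)
    {A : Finset (ℕ × ℤ)} (hA : ∀ a ∈ A, 0 < a.1 ∧ a.2 ≠ 0) (hn : 0 < n) (hM : ∀ m ∈ M, m < n) :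
    P {ω | ∀ m ∈ M, (sceneryWalk fun k => ξ k ω, fun k => S k ω) ∈ allStraight n A m} =
      ((3 / 4) ^ (A.card + (A.image Prod.snd).card)) ^ M.card := by
  have hmeas : MeasurableSet {x | ∀ m ∈ M, x ∈ allStraight n A m} := by
    simp only [Set.ofPred_forall]
    exact Finset.measurableSet_biInter _ fun m _ =>
      measurableSet_allStraight n (fun a ha => (hA a ha).2) m
  rw [← pow_mul, add_mul, pow_add, ← hξ.measure_mem_straightScenery
    (Finset.forall_mem_image.2 fun a ha => (hA a ha).2) hM]
  refine measure_pair_mem_eq_mul hξ.measurable_sceneryWalk hS.measurable_path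
    (hindep.comp measurable_sceneryWalk measurable_id) hmeas
    (measurableSet_straightScenery _ _ _) ?_
  filter_upwards [hξ.ae_isNearestNeighbor_and_isRecurrent] with ω hω
  obtain ⟨k, j, hfamily⟩ := exists_isCrossingFamily hn hω.1 hω.2
  exact hfamily.measure_forall_mem_allStraight hω.1 hS hA hM

end Probability

/-! ### The law of the test statistic -/

theorem IsIndexedCrossing.isSignedCrossing_apply {R : ℤ → ℤ} {S : ℕ → ℤ} {n i : ℕ} {z : ℤ}
    {t : ℕ × ℕ} (ht : IsIndexedCrossing R S n i z t) :
    IsSignedCrossing R 0 (3 * n) z (S t.1, S t.2) := by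
  obtain ⟨k, hk, ht⟩ := ht
  rwa [ht.1.2.1, ht.1.2.2.1]

theorem IsIndexedCrossing.apply_eq_iff {R : ℤ → ℤ} {S : ℕ → ℤ} {n ia ib : ℕ} {za zb : ℤ}
    (hza : za ≠ 0) {ta tb : ℕ × ℕ} (hta : IsIndexedCrossing R S n ia za ta)
    (htb : IsIndexedCrossing R S n ib zb tb) :
    (S ta.1, S ta.2) = (S tb.1, S tb.2) ↔ za = zb := by
  refine ⟨fun h => ?_, ?_⟩
  · exact hta.isSignedCrossing_apply.index_unique (h ▸ htb.isSignedCrossing_apply)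
  · rintro rfl
    exact hta.isSignedCrossing_apply.unique hza htb.isSignedCrossing_apply

theorem IsIndexedCrossing.isCrossing {R : ℤ → ℤ} {S : ℕ → ℤ} {n i : ℕ} {z : ℤ}
    {t : ℕ × ℕ} (ht : IsIndexedCrossing R S n i z t) :
    IsCrossing (fun u => R (S u)) 0 (3 * n) t := by
  obtain ⟨k, hk, ht⟩ := ht
  exact hk.1.comp ht.1

theorem commonStraight_eq_ncard (T : ℕ → ℤ) (n : ℕ) (a b : ℕ × ℕ) : commonStraight T n a b =
    {m | m < n ∧ straightBit T a m = 1 ∧ straightBit T b m = 1}.ncard := by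
  have hbit : ∀ t m, straightBit T t m = 0 ∨ straightBit T t m = 1 := fun t m => by
    unfold straightBit
    split_ifs
    exacts [.inr rfl, .inl rfl]
  have hmul : ∀ m, straightBit T a m * straightBit T b m =
      if straightBit T a m = 1 ∧ straightBit T b m = 1 then 1 else 0 := fun m => by
    rcases hbit a m with ha | ha <;> rcases hbit b m with hb | hb <;> simp [ha, hb]
  simp only [commonStraight, hmul, Finset.sum_boole, Nat.cast_id]
  rw [← Set.ncard_coe_finset, Finset.coe_filter]
  simp only [Finset.mem_range]

theorem mem_allStraight_pair_iff {r : ℤ → ℤ} {σ : ℕ → ℤ} {n m ia ib : ℕ} {za zb : ℤ}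
    (hza : za ≠ 0) (hzb : zb ≠ 0) {ta tb : ℕ × ℕ} (hta : IsIndexedCrossing r σ n ia za ta)
    (htb : IsIndexedCrossing r σ n ib zb tb) :
    (r, σ) ∈ allStraight n {(ia, za), (ib, zb)} m ↔
      straightBit (fun u => r (σ u)) ta m = 1 ∧ straightBit (fun u => r (σ u)) tb m = 1 := by
  have hexists : ∀ {i z t}, z ≠ 0 → IsIndexedCrossing r σ n i z t →
      ((∃ s, IsIndexedCrossing r σ n i z s ∧ straightBit (fun u => r (σ u)) s m = 1) ↔
        straightBit (fun u => r (σ u)) t m = 1) := fun hz ht =>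
    ⟨fun ⟨_, hs, hbit⟩ => hs.unique hz ht ▸ hbit, fun hbit => ⟨_, ht, hbit⟩⟩
  simp only [allStraight, Set.mem_ofPred_eq, Finset.forall_mem_insert, Finset.mem_singleton,
    forall_eq, hexists hza hta, hexists hzb htb]

theorem coe_toNNReal_threeQuarters_pow (c : ℕ) :
    (unitInterval.toNNReal (threeQuarters ^ c) : ENNReal) = (3 / 4) ^ c := by
  have hpow : unitInterval.toNNReal (threeQuarters ^ c) = (3 / 4) ^ c :=
    NNReal.eq (by simp [threeQuarters])
  rw [hpow, ENNReal.coe_pow, ENNReal.coe_div four_ne_zero, ENNReal.coe_ofNat, ENNReal.coe_ofNat]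

section Probability

variable {Ω : Type*} [MeasurableSpace Ω] {P : Measure Ω} [IsProbabilityMeasure P]
  {ξ : ℤ → Ω → Fin 2} {S : ℕ → Ω → ℤ} {n : ℕ}

theorem ae_isIndexedCrossing_indexedCrossing (hξ : IsFairScenery P ξ) (hS : IsSimpleRandomWalk P S)
    (hn : 0 < n) {i : ℕ} (hi : 0 < i) {z : ℤ} (hz : z ≠ 0) :
    ∀ᵐ ω ∂P, IsIndexedCrossing (sceneryWalk fun k => ξ k ω) (fun k => S k ω) n i z
      (indexedCrossing (sceneryWalk fun k => ξ k ω) (fun k => S k ω) n i z) := by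
  filter_upwards [hξ.ae_isNearestNeighbor_and_isRecurrent, hS.ae_isNearestNeighbor,
    hS.ae_isRecurrent] with ω hω hσ hrec
  obtain ⟨k, j, hfamily⟩ := exists_isCrossingFamily hn hω.1 hω.2
  exact Classical.epsilon_spec (hfamily.exists_isIndexedCrossing hσ hrec hi hz)

theorem hasLaw_commonStraight (hξ : IsFairScenery P ξ) (hS : IsSimpleRandomWalk P S)
    (hindep : IndepFun (fun ω k => ξ k ω) (fun ω k => S k ω) P) (hn : 0 < n) {za zb : ℤ}
    (hza : za ≠ 0) (hzb : zb ≠ 0) {ia ib : ℕ} (hia : 0 < ia) (hib : 0 < ib) :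
    HasLaw (fun ω => commonStraight (fun u => sceneryWalk (fun k => ξ k ω) (S u ω)) n
        (indexedCrossing (sceneryWalk fun k => ξ k ω) (fun k => S k ω) n ia za)
        (indexedCrossing (sceneryWalk fun k => ξ k ω) (fun k => S k ω) n ib zb))
      (binomial n (threeQuarters ^ (({(ia, za), (ib, zb)} : Finset (ℕ × ℤ)).card +
        ({za, zb} : Finset ℤ).card))) P := by
  have hA : ∀ a ∈ ({(ia, za), (ib, zb)} : Finset (ℕ × ℤ)), 0 < a.1 ∧ a.2 ≠ 0 := by
    simp [*]
  have himage : ({(ia, za), (ib, zb)} : Finset (ℕ × ℤ)).image Prod.snd = {za, zb} := by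
    simp only [Finset.image_insert, Finset.image_singleton]
  refine (hasLaw_ncard_binomial_of_measure_biInter
    (E := fun m => {ω | (sceneryWalk fun k => ξ k ω, fun k => S k ω) ∈
      allStraight n {(ia, za), (ib, zb)} m}) (fun m => ?_) fun M hM => ?_).congr ?_
  · exact (hξ.measurable_sceneryWalk.prodMk hS.measurable_path)
      (measurableSet_allStraight n (fun a ha => (hA a ha).2) m)
  · rw [coe_toNNReal_threeQuarters_pow, ← himage, ← measure_forall_mem_allStraight hξ hS hindep hA
      hn fun m hm => Finset.mem_range.1 (hM hm)]
    simp only [Set.ofPred_forall]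
  · filter_upwards [ae_isIndexedCrossing_indexedCrossing hξ hS hn hia hza,
      ae_isIndexedCrossing_indexedCrossing hξ hS hn hib hzb] with ω hta htb
    simp only [commonStraight_eq_ncard, mem_allStraight_pair_iff hza hzb hta htb]

end Probability

theorem lemma8 {Ω : Type*} [MeasurableSpace Ω] (P : Measure Ω) [IsProbabilityMeasure P]
    (ξ : ℤ → Ω → Fin 2) (S : ℕ → Ω → ℤ)
    (hξ : IsFairScenery P ξ) (hS : IsSimpleRandomWalk P S)
    (hindep : IndepFun (fun ω k => ξ k ω) (fun ω k => S k ω) P)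
    (R : Ω → ℤ → ℤ) (hR : R = fun ω => sceneryWalk (fun k => ξ k ω))
    (T : Ω → ℕ → ℤ) (hT : T = fun ω k => R ω (S k ω))
    (n : ℕ) (hn : 0 < n) (za zb : ℤ) (hza : za ≠ 0) (hzb : zb ≠ 0)
    (ia ib : ℕ) (hia : 0 < ia) (hib : 0 < ib) (hab : (ia, za) ≠ (ib, zb))
    (ta tb : Ω → ℕ × ℕ)
    (hta : ta = fun ω => indexedCrossing (R ω) (fun k => S k ω) n ia za)
    (htb : tb = fun ω => indexedCrossing (R ω) (fun k => S k ω) n ib zb) :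
    (∀ᵐ ω ∂P,
      IsIndexedCrossing (R ω) (fun k => S k ω) n ia za (ta ω) ∧
      IsIndexedCrossing (R ω) (fun k => S k ω) n ib zb (tb ω) ∧
      IsCrossing (T ω) 0 (3 * n) (ta ω) ∧ IsCrossing (T ω) 0 (3 * n) (tb ω)) ∧
    (za = zb →
      (∀ᵐ ω ∂P, (S (ta ω).1 ω, S (ta ω).2 ω) = (S (tb ω).1 ω, S (tb ω).2 ω)) ∧
      HasLaw (fun ω => commonStraight (T ω) n (ta ω) (tb ω)) (binomial n (threeQuarters ^ 3)) P) ∧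
    (za ≠ zb →
      (∀ᵐ ω ∂P, (S (ta ω).1 ω, S (ta ω).2 ω) ≠ (S (tb ω).1 ω, S (tb ω).2 ω)) ∧
      HasLaw (fun ω => commonStraight (T ω) n (ta ω) (tb ω)) (binomial n (threeQuarters ^ 4)) P) := by
  subst hR hT hta htb
  have ha := ae_isIndexedCrossing_indexedCrossing hξ hS hn hia hza
  have hb := ae_isIndexedCrossing_indexedCrossing hξ hS hn hib hzb
  have hlaw := hasLaw_commonStraight hξ hS hindep hn hza hzb hia hib
  rw [Finset.card_pair hab] at hlaw
  refine ⟨?_, fun hz => ⟨?_, ?_⟩, fun hz => ⟨?_, ?_⟩⟩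
  · filter_upwards [ha, hb] with ω hta htb
    exact ⟨hta, htb, hta.isCrossing, htb.isCrossing⟩
  · filter_upwards [ha, hb] with ω hta htb
    exact (hta.apply_eq_iff hza htb).2 hz
  · simpa only [hz, Finset.pair_eq_singleton, Finset.card_singleton] using hlaw
  · filter_upwards [ha, hb] with ω hta htb
    exact (hta.apply_eq_iff hza htb).not.2 hz
  · rwa [Finset.card_pair hz] at hlaw
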